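/- **Setting.** Let $M=(\mathcal S,s_0,g,\mathcal A,P)$ be an MDP with finite state space $\mathcal S$, initial state $s_0\in\mathcal S$, absorbing goal state $g\notin\mathcal S$, finite action sets $\mathcal A_s$, and transition law $P(\cdot\mid s,a)$ on $\mathcal S\cup\{g\}$; let $\Gamma=\{(s,a):s\in\mathcal S,a\in\mathcal A_s\}$. A stationary policy is proper if it reaches $g$ almost surely from every state. Assume that deterministic proper policies exist. Write $T^\pi(s)$ for the expected number of steps of $\pi$ from $s$ to $g$. The fast policy $\pi^f$ is a deterministic proper policy that minimizes $T^\pi(s)$ among the deterministic proper policies for every $s$, and $D=\max_s\min_\pi T^\pi(s)=\max_s T^{\pi^f}(s)$. For a cost $c:\Gamma\to[0,1]$, $J^\pi_c(s)$ is the expected total cost of $\pi$ from $s$ until $g$ is reached. **Loop-free instance.** For $H_1\ge1$, $H_2\ge 0$ and $H=H_1+H_2$, the loop-free instance $\widetilde M$ has states $(\mathcal S\cup\{s_f\})\times\{1,\dots,H\}$ with an added state $s_f$, initial state $(s_0,1)$ and goal $g$. The actions at $(s,h)$ are those of $s$, and the only action at $(s_f,h)$ is an added one, $a_f$. From $(s,h)$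 with $s\in\mathcal S$, $h<H_1$ and action $a$, one moves to $(s',h+1)$ with probability $P(s'\mid s,a)$ and to $g$ with probability $P(g\mid s,a)$. From every other state of layer $h$ (that is, from layers $h\ge H_1$, and from $s_f$) one moves to $(s_f,h+1)$ if $h<H$ and to $g$ if $h=H$. A cost $c$ is extended by $c(s,a,h)=c(s,a)$ and $c(s_f,a_f,h)=1$. For a policy $\widetilde\pi$ of $\widetilde M$, $q_{\widetilde\pi}(s,a,h)$ is the expected number of visits to $(s,a,h)$, $\langle f,g\rangle=\sum f(s,a,h)\,g(s,a,h)$, and $(\vec h\circ c)(s,a,h)=h\cdot c(s,a,h)$. The policy $\sigma(\widetilde\pi)$ of $M$ plays $\widetilde\pi(\cdot\mid(s,h))$ in step $h$ at state $s$ for $h\le H_1$, and plays $\pi^f$ after the first $H_1$ steps. **Protocol.** There are $K\ge 1$ episodes. Let $\mathcal F_k$ be the $\sigma$-algebra of events up to the beginning of episode $k$. The costs $c_k:\Gamma\to[0,1]$ (chosen by an adaptive environment) and the policies $\widetilde\pi_k$ of $\widetilde M$ (chosen by the learner) are $\mathcal F_k$-measurable, and, given $\mathcal F_k$, the trajectory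 of episode $k$ is a trajectory of $\sigma(\widetilde\pi_k)$ in $M$ from $s_0$, with steps $(s_k^i,a_k^i)$, $i=1,\dots,I_k$, until $g$ is reached. Let $\pi^\star$ be a (measurable choice of a) minimizer of $\sum_k J^\pi_{c_k}(s_0)$ over the deterministic proper policies, $T_{\max}=\max_sT^{\pi^\star}(s)$, and $$R_K=\sum_{k=1}^K\sum_{i=1}^{I_k}c_k(s_k^i,a_k^i)-\sum_{k=1}^K J^{\pi^\star}_{c_k}(s_0).$$ Let $\widetilde\pi^\star$ be the policy of $\widetilde M$ that plays $\pi^\star(s)$ at $(s,h)$, let $q_k=q_{\widetilde\pi_k}$, and let $\widetilde N_k(s,a,h)=1$ if $h\le H_1$ and $(s_k^h,a_k^h)=(s,a)$, $\widetilde N_k(s_f,a_f,h)=1$ if $h>H_1$ and the state at the time of step $H_1$ of episode $k$ is not $g$, and $\widetilde N_k=0$ otherwise. Put $\textsc{Reg}=\sum_{k=1}^K\langle q_k-q_{\widetilde\pi^\star},c_k\rangle$. **Claim.** There is an absolute constant $C>0$ such that the following holds whenever $\delta\in(0,1)$, $H_2=\lceil 4D\ln(4K/\delta)\rceil$, $H_1\ge1$,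 and $H_1\ge 8T_{\max}\ln K$ almost surely. Let $$r=C\,\max\{1,D/K\}\,\ln(4K/\delta),$$ which is $C\ln(4K/\delta)=\widetilde O(1)$ if $K\ge D$. 1. For every $\lambda\in(0,2/H]$, with probability at least $1-\delta$, both $$R_K\le\sum_{k=1}^K\langle\widetilde N_k-q_{\widetilde\pi^\star},c_k\rangle+r$$ and $$\sum_{k=1}^K\langle\widetilde N_k-q_{\widetilde\pi^\star},c_k\rangle\le\sum_{k=1}^K\langle q_k-q_{\widetilde\pi^\star},c_k\rangle+\lambda\sum_{k=1}^K\langle q_k,\vec h\circ c_k\rangle+\frac{2\ln(2/\delta)}{\lambda},$$ and hence $$R_K\le\sum_{k=1}^K\langle q_k-q_{\widetilde\pi^\star},c_k\rangle+\lambda\sum_{k=1}^K\langle q_k,\vec h\circ c_k\rangle+\frac{2\ln(2/\delta)}{\lambda}+r .$$ 2. $R_K$ and $\textsc{Reg}$ are integrable, and $\mathbb E[R_K]\le\mathbb E[\textsc{Reg}]+r$. -/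

import Mathlib

open MeasureTheory ProbabilityTheory
open scoped ENNReal

universe u v w

/-- One step of an episode: `some ⟨s, a⟩` means that the current state is `s` and that action `a`
is taken there; `none` means that the goal state has already been reached. -/
abbrev Step {S : Type u} (A : S → Type v) : Type (max u v) := Option (Σ s, A s)

instance Step.instMeasurableSpace {S : Type u} {A : S → Type v} : MeasurableSpace (Step A) := ⊤

instance Step.instDiscrete {S : Type u} {A : S → Type v} : DiscreteMeasurableSpace (Step A) :=
  ⟨fun _ => trivial⟩

/-- A stationary policy: `π s` is the distribution of the action taken in state `s`. -/
abbrev Policy {S : Type u} (A : S → Type v) : Type (max u v) := ∀ s : S, PMF (A s)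

/-- The stationary policy that takes the action `π s` in state `s`. -/
noncomputable def detPolicy {S : Type u} {A : S → Type v} (π : ∀ s, A s) : Policy A :=
  fun s => PMF.pure (π s)

/-- A stochastic-shortest-path MDP with state space `S`, action sets `A s`, an initial state
and a transition law. A next state is an element of `Option S`; `none` is the goal state `g`. -/
structure SSP (S : Type u) (A : S → Type v) where
  init : S
  P : ∀ s : S, A s → PMF (Option S)

namespace SSP

variable {S : Type u} {A : S → Type v}

/-- From the current state, draw an action from `π` and record the pair;
nothing more happens at the goal. -/
noncomputable def act (π : Policy A) : Option S → PMF (Step A)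
  | none => PMF.pure none
  | some s => (π s).map fun a => some ⟨s, a⟩

/-- One transition: move according to `P`, then draw the next action from `π`.
The goal is absorbing. -/
noncomputable def step (M : SSP S A) (π : Policy A) : Step A → PMF (Step A)
  | none => PMF.pure none
  | some p => (M.P p.1 p.2).bind (act π)

variable [Fintype S] [∀ s, Fintype (A s)]

/-- The transition to time `n + 1`, when the action at time `n + 1` is drawn from `ρ (n + 1)`, as a
kernel from histories up to time `n`. -/
noncomputable def stepKernel (M : SSP S A) (ρ : ℕ → Policy A) (n : ℕ) :
    Kernel (∀ _ : Finset.Iic n, Step A) (Step A) :=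
  Kernel.comap (Kernel.ofFunOfCountable fun y => (M.step (ρ (n + 1)) y).toMeasure)
    (fun x => x ⟨n, Finset.mem_Iic.2 le_rfl⟩) (measurable_pi_apply _)

instance (M : SSP S A) (ρ : ℕ → Policy A) (n : ℕ) : IsMarkovKernel (M.stepKernel ρ n) := by
  refine ⟨fun x => ?_⟩
  rw [stepKernel, Kernel.comap_apply]
  exact PMF.toMeasure.isProbabilityMeasure _

/-- The law of the trajectory started in state `s` when the action at time `n = 0, 1, 2, …` is
drawn from the stationary policy `ρ n` (a possibly nonstationary Markov policy). -/
noncomputable def trajLaw (M : SSP S A) (ρ : ℕ → Policy A) (s : S) : Measure (ℕ → Step A) :=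
  Kernel.trajMeasure (X := fun _ => Step A) (act (ρ 0) (some s)).toMeasure (M.stepKernel ρ)

/-- The number of steps of an episode before the goal is reached. -/
noncomputable def numSteps (x : ℕ → Step A) : ℝ≥0∞ :=
  open Classical in ∑' i, if x i = none then 0 else 1

/-- The number of visits of a trajectory to the state-action pair `p`. -/
noncomputable def visits (x : ℕ → Step A) (p : Σ s, A s) : ℝ≥0∞ :=
  open Classical in ∑' i, if x i = some p then 1 else 0

/-- The cost of one step: `c (s, a)` before the goal is reached, and `0` at the goal. -/
def stepCost (c : (Σ s, A s) → ℝ) : Step A → ℝ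
  | none => 0
  | some p => c p

/-- The expected hitting time `T^π(s)` of the goal from `s` under the stationary policy `π`. -/
noncomputable def hitTime (M : SSP S A) (π : Policy A) (s : S) : ℝ≥0∞ :=
  ∫⁻ x, numSteps x ∂(M.trajLaw (fun _ => π) s)

/-- The cost-to-go `J^π(s)`: the expected total cost of an episode of `π` started at `s`
(for costs `c ≥ 0`). -/
noncomputable def costToGo (M : SSP S A) (π : Policy A) (c : (Σ s, A s) → ℝ) (s : S) : ℝ :=
  (∫⁻ x, ∑' i, ENNReal.ofReal (stepCost c (x i)) ∂(M.trajLaw (fun _ => π) s)).toReal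

/-- The occupancy measure `q_π`: expected numbers of visits, starting from the initial state. -/
noncomputable def occ (M : SSP S A) (π : Policy A) (p : Σ s, A s) : ℝ :=
  (∫⁻ x, visits x p ∂(M.trajLaw (fun _ => π) M.init)).toReal

/-- `π` is proper: from every state the goal is reached in finitely many steps almost surely. -/
def Proper (M : SSP S A) (π : Policy A) : Prop :=
  ∀ s, ∀ᵐ x ∂(M.trajLaw (fun _ => π) s), ∃ i, x i = none

/-- `π` is a fast policy: deterministic, proper, and of minimum expected hitting time from every
state among all deterministic proper policies. -/
def IsFast (M : SSP S A) (π : ∀ s, A s) : Prop :=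
  M.Proper (detPolicy π) ∧
    ∀ π' : ∀ s, A s, M.Proper (detPolicy π') →
      ∀ s, M.hitTime (detPolicy π) s ≤ M.hitTime (detPolicy π') s

/-- The diameter `D`: the maximum over states of the minimum, over all deterministic proper
policies, of the expected hitting time. -/
noncomputable def diameter (M : SSP S A) : ℝ :=
  (⨆ s, ⨅ π : ∀ s, A s, ⨅ _ : M.Proper (detPolicy π), M.hitTime (detPolicy π) s).toReal

/-- The largest expected hitting time of `π` from any state. -/
noncomputable def maxHitTime (M : SSP S A) (π : Policy A) : ℝ :=
  (⨆ s, M.hitTime π s).toReal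

/-- `π` is an optimal policy in hindsight for the costs `c_1, …, c_K`: it minimizes
`∑ k, J_k^π(s₀)` over the deterministic proper policies. -/
def IsBest (M : SSP S A) {K : ℕ} (c : Fin K → (Σ s, A s) → ℝ) (π : ∀ s, A s) : Prop :=
  M.Proper (detPolicy π) ∧
    ∀ π' : ∀ s, A s, M.Proper (detPolicy π') →
      ∑ k, M.costToGo (detPolicy π) (c k) M.init ≤ ∑ k, M.costToGo (detPolicy π') (c k) M.init

/-- The regret `R_K` for the realized trajectories `x k` and costs `c k`, where `π` is an optimal
policy in hindsight. -/
noncomputable def regret (M : SSP S A) {K : ℕ} (c : Fin K → (Σ s, A s) → ℝ)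
    (x : Fin K → ℕ → Step A) (π : ∀ s, A s) : ℝ :=
  ∑ k, ∑' i, stepCost (c k) (x k i) - ∑ k, M.costToGo (detPolicy π) (c k) M.init

end SSP

namespace LoopFree

/-- The states of the loop-free instance, `(S ∪ {s_f}) × [H]`. `Sum.inr ()` is the added fast
state `s_f`, and the element `h` of `Fin H` stands for the layer `h + 1` of `{1, …, H}`. -/
abbrev State (S : Type u) (H : ℕ) : Type u := (S ⊕ Unit) × Fin H

/-- The actions of the loop-free instance: those of `s` at `(s, h)`, and a single added action
`a_f` at `(s_f, h)`. -/
abbrev Action {S : Type u} (A : S → Type v) (H : ℕ) (t : State S H) : Type v :=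
  Sum.elim A (fun _ => PUnit.{v + 1}) t.1

instance Action.instFintype {S : Type u} {A : S → Type v} [∀ s, Fintype (A s)] {H : ℕ} :
    ∀ t : State S H, Fintype (Action A H t)
  | (Sum.inl s, _) => inferInstanceAs (Fintype (A s))
  | (Sum.inr _, _) => inferInstanceAs (Fintype PUnit)

/-- The state-action-layer triples of the loop-free instance. -/
abbrev Triple {S : Type u} (A : S → Type v) (H : ℕ) : Type (max u v) :=
  Σ t : State S H, Action A H t

variable {S : Type u} {A : S → Type v}

/-- The fast state of the layer after `h`, or the goal if `h` is the last layer. -/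
def nextFast {H : ℕ} (h : Fin H) : Option (State S H) :=
  if hh : h.1 + 1 < H then some (Sum.inr (), ⟨h.1 + 1, hh⟩) else none

/-- The transition law of the loop-free instance. In a layer before layer `H₁` one moves as in the
original MDP and goes to the next layer. From layer `H₁` on one moves to the fast state of the next
layer, and from the last layer `H` to the goal. -/
noncomputable def trans (M : SSP S A) (H₁ H₂ : ℕ) :
    ∀ t : State S (H₁ + H₂), Action A (H₁ + H₂) t → PMF (Option (State S (H₁ + H₂)))
  | (Sum.inl s, h), a =>
    if hh : h.1 + 1 < H₁ then
      (M.P s a).map (Option.map fun s' => (Sum.inl s', ⟨h.1 + 1, Nat.lt_add_right H₂ hh⟩))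
    else PMF.pure (nextFast h)
  | (Sum.inr _, h), _ => PMF.pure (nextFast h)

/-- The loop-free version of `M` with horizon `H₁ + H₂`, started in layer `1` at the initial state
of `M`. -/
noncomputable def inst (M : SSP S A) (H₁ H₂ : ℕ) (h₁ : 0 < H₁) :
    SSP (State S (H₁ + H₂)) (Action A (H₁ + H₂)) where
  init := (Sum.inl M.init, ⟨0, Nat.lt_add_right H₂ h₁⟩)
  P := trans M H₁ H₂

/-- The cost function of the loop-free instance: `c (s, a)` at `(s, a, h)`, and `1` at
`(s_f, a_f, h)`. -/
def cost {H : ℕ} (c : (Σ s, A s) → ℝ) : Triple A H → ℝ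
  | ⟨(Sum.inl s, _), a⟩ => c ⟨s, a⟩
  | ⟨(Sum.inr _, _), _⟩ => 1

/-- The function `h ∘ f`, with value `h · f (s, a, h)` at `(s, a, h)`, for layers
`h ∈ {1, …, H}`. -/
def layerMul {H : ℕ} (f : Triple A H → ℝ) (p : Triple A H) : ℝ :=
  ((p.1.2.1 : ℝ) + 1) * f p

/-- `⟨f, g⟩ = ∑ f (s, a, h) g (s, a, h)`. -/
def pairing [Fintype S] [∀ s, Fintype (A s)] {H : ℕ} (f g : Triple A H → ℝ) : ℝ :=
  ∑ p, f p * g p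

/-- The policy `σ(π̃)` of `M`: follow the policy `π̃` of the loop-free instance for the first
`H₁` steps, and the fast policy `πf` afterwards. Index `i` stands for step `i + 1`. -/
noncomputable def sigma (H₁ H₂ : ℕ) (πf : ∀ s, A s) (π : Policy (Action A (H₁ + H₂))) (i : ℕ) :
    Policy A :=
  fun s => if hi : i < H₁ then π (Sum.inl s, ⟨i, Nat.lt_add_right H₂ hi⟩) else PMF.pure (πf s)

/-- The policy of the loop-free instance that mimics the policy `π` of `M`: it takes the action
`π s` at `(s, h)`. -/
def mimic {H : ℕ} (π : ∀ s, A s) : ∀ t : State S H, Action A H t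
  | (Sum.inl s, _) => π s
  | (Sum.inr _, _) => PUnit.unit

/-- The visit counts `Ñ` in the loop-free instance that correspond to a trajectory `x` of `M`:
`(s, a, h)` with `h ≤ H₁` is visited if `(s, a)` is the state-action pair of step `h`, and
`(s_f, a_f, h)` with `h > H₁` is visited if the goal is not yet reached at the time of step `H₁`. -/
noncomputable def visits (H₁ H₂ : ℕ) (x : ℕ → Step A) : Triple A (H₁ + H₂) → ℝ
  | ⟨(Sum.inl s, h), a⟩ => open Classical in if h.1 < H₁ ∧ x h.1 = some ⟨s, a⟩ then 1 else 0
  | ⟨(Sum.inr _, h), _⟩ => open Classical in if H₁ ≤ h.1 ∧ x (H₁ - 1) ≠ none then 1 else 0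

/-- The loop-free occupancy measure `q_π̃` of a policy `π̃` of the loop-free instance. -/
noncomputable def occ [Fintype S] [∀ s, Fintype (A s)] (M : SSP S A) (H₁ H₂ : ℕ) (h₁ : 0 < H₁)
    (π : Policy (Action A (H₁ + H₂))) : Triple A (H₁ + H₂) → ℝ :=
  (inst M H₁ H₂ h₁).occ π

/-- The loop-free occupancy measure `q_π̃⋆` of the policy `π̃⋆` that mimics `π⋆`. -/
noncomputable def occStar [Fintype S] [∀ s, Fintype (A s)] (M : SSP S A) (H₁ H₂ : ℕ) (h₁ : 0 < H₁)
    (πs : ∀ s, A s) : Triple A (H₁ + H₂) → ℝ :=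
  occ M H₁ H₂ h₁ (detPolicy (mimic πs))

/-- The loop-free regret `∑ k, ⟨q_k - q_π̃⋆, c_k⟩`, where `q_k` is the occupancy measure of the
policy `π k` of the loop-free instance. -/
noncomputable def regret [Fintype S] [∀ s, Fintype (A s)] (M : SSP S A) (H₁ H₂ : ℕ) (h₁ : 0 < H₁)
    {K : ℕ} (c : Fin K → (Σ s, A s) → ℝ) (π : Fin K → Policy (Action A (H₁ + H₂)))
    (πs : ∀ s, A s) : ℝ :=
  ∑ k, pairing (occ M H₁ H₂ h₁ (π k) - occStar M H₁ H₂ h₁ πs) (cost (c k))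

/-- The realized loop-free regret `∑ k, ⟨Ñ_k - q_π̃⋆, c_k⟩`, where `Ñ_k` are the visit counts of the
trajectory `x k`. -/
noncomputable def realizedRegret [Fintype S] [∀ s, Fintype (A s)] (M : SSP S A) (H₁ H₂ : ℕ)
    (h₁ : 0 < H₁) {K : ℕ} (c : Fin K → (Σ s, A s) → ℝ) (x : Fin K → ℕ → Step A)
    (πs : ∀ s, A s) : ℝ :=
  ∑ k, pairing (visits H₁ H₂ (x k) - occStar M H₁ H₂ h₁ πs) (cost (c k))

/-- The learning protocol. In episode `k`, given everything that happened before (`𝓕 k`), the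
environment chooses a cost function `c k` and the learner chooses a policy `π k` of the loop-free
instance. The learner then executes `σ(π k)` in `M` from the initial state, which produces the
trajectory `X k`; its law given `𝓕 k` is the law of a trajectory of `σ(π k)`. -/
structure IsPlay [Fintype S] [∀ s, Fintype (A s)] (M : SSP S A) (πf : ∀ s, A s) (H₁ H₂ : ℕ)
    {Ω : Type w} {mΩ : MeasurableSpace Ω} (μ : Measure Ω) (𝓕 : Filtration ℕ mΩ) {K : ℕ}
    (c : Fin K → Ω → (Σ s, A s) → ℝ) (π : Fin K → Ω → Policy (Action A (H₁ + H₂)))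
    (X : Fin K → Ω → ℕ → Step A) : Prop where
  cost_mem : ∀ k ω p, 0 ≤ c k ω p ∧ c k ω p ≤ 1
  cost_adapted : ∀ (k : Fin K) p, Measurable[𝓕 (k : ℕ)] fun ω => c k ω p
  policy_adapted : ∀ (k : Fin K) t a, Measurable[𝓕 (k : ℕ)] fun ω => π k ω t a
  traj_adapted : ∀ (k : Fin K) (i : ℕ), Measurable[𝓕 ((k : ℕ) + 1)] fun ω => X k ω i
  traj_law : ∀ (k : Fin K) (B : Set (ℕ → Step A)), MeasurableSet B →
    μ⟦X k ⁻¹' B|𝓕 (k : ℕ)⟧ =ᵐ[μ] fun ω => (M.trajLaw (sigma H₁ H₂ πf (π k ω)) M.init).real B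

end LoopFree

/-! The theorem rests on two decay estimates and one exponential inequality. Let $S_n$ be the
probability that a stationary policy has not reached $g$ at time $n$, and let all its expected
hitting times be at most $D$. The Markov property gives $U_n=\sum_{j\ge n}S_j\le D\,S_n$, hence
$U_{n+1}=U_n-S_n\le(1-1/D)U_n$ and $U_n\le De^{-n/D}$. Since $S$ is nonincreasing, a window of about
$D$ terms improves this to $S_n\le e^{1-n/D}$, without the factor $D$ (`tsum_surv_le`,
`surv_le_exp`).

For $\pi^f$, which runs after the first $H_1$ steps, these bounds make all episodes end within $H$
steps with probability at least $1-\delta/2$, and the expected total number of later steps is at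
most $D/K$. As long as an episode stays within $H$ steps, its cost is at most $\langle\widetilde
N_k,c_k\rangle$, because the loop-free instance charges $1$ in each of the $H_2$ last layers. For
$\pi^\star$, the same decay shows that the loop-free cost exceeds $J^{\pi^\star}$ by at most
$H_2e^{1-(H_1-1)/T_{\max}}$ per episode (`regret_le`).

The loop-free chain is an image of the original one, stopped in layer $H_1$ (`stateLaw_inst`), so
$q_k$ is the conditional mean of $\widetilde N_k$. This settles the expectation bound. For the
deviation bound, put $Y=\langle\widetilde N_k,c_k\rangle$. At most one triple per layer is visited,
so $Y^2\le2\langle\widetilde N_k,\vec h\circ c_k\rangle$ (`sq_sum_le`), and with $\eta=\lambda/2$,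
$e^{\eta Y}\le1+\eta Y+2\eta^2\langle\widetilde N_k,\vec h\circ c_k\rangle$. Conditional
expectations turn this into an exponential supermartingale, to which Markov's inequality applies
(`measure_visits_gt_le`). The comparator, which is not adapted, cancels throughout this step. -/

namespace SSP

/-! ### One-time laws of a nonstationary Markov policy -/

section StateLaw

variable {S : Type u} {A : S → Type v}

/-- The law of the next state, given the current step. -/
noncomputable def move (M : SSP S A) : Step A → PMF (Option S)
  | none => PMF.pure none
  | some p => M.P p.1 p.2

theorem step_eq_bind (M : SSP S A) (π : Policy A) (y : Step A) :
    M.step π y = (M.move y).bind (act π) := by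
  cases y with
  | none => simp [step, move, act]
  | some p => rfl

/-- The law of the state at time `n` when the process is started at `o` and follows `ρ`. -/
noncomputable def stateLaw (M : SSP S A) (ρ : ℕ → Policy A) : ℕ → Option S → PMF (Option S)
  | 0, o => PMF.pure o
  | n + 1, o => (stateLaw M ρ n o).bind fun o' => (act (ρ n) o').bind M.move

/-- The law of the step at time `n` when the process is started at `o` and follows `ρ`. -/
noncomputable def stepLaw (M : SSP S A) (ρ : ℕ → Policy A) (n : ℕ) (o : Option S) : PMF (Step A) :=
  (M.stateLaw ρ n o).bind (act (ρ n))

theorem stepLaw_succ (M : SSP S A) (ρ : ℕ → Policy A) (n : ℕ) (o : Option S) :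
    M.stepLaw ρ (n + 1) o = (M.stepLaw ρ n o).bind (M.step (ρ (n + 1))) := by
  simp only [stepLaw, stateLaw, PMF.bind_bind, funext (step_eq_bind M (ρ (n + 1)))]

theorem act_bind_move (M : SSP S A) (π : Policy A) (s : S) :
    (act π (some s)).bind M.move = (π s).bind (M.P s) := by
  rw [act, PMF.bind_map]
  rfl

theorem stateLaw_none (M : SSP S A) (ρ : ℕ → Policy A) (n : ℕ) :
    M.stateLaw ρ n none = PMF.pure none := by
  induction n with
  | zero => rfl
  | succ n ih => simp [stateLaw, ih, act, move]

/-- Markov property (Chapman–Kolmogorov): the restarted process follows the policy sequence shifted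
by `m`. -/
theorem stateLaw_add (M : SSP S A) (ρ : ℕ → Policy A) (m n : ℕ) (o : Option S) :
    M.stateLaw ρ (m + n) o =
      (M.stateLaw ρ m o).bind (M.stateLaw (fun i => ρ (m + i)) n) := by
  induction n with
  | zero => simp [stateLaw]
  | succ n ih => rw [← add_assoc, stateLaw, ih, PMF.bind_bind]; rfl

theorem stateLaw_congr (M : SSP S A) {ρ ρ' : ℕ → Policy A} (n : ℕ) (h : ∀ i < n, ρ i = ρ' i)
    (o : Option S) : M.stateLaw ρ n o = M.stateLaw ρ' n o := by
  induction n with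
  | zero => rfl
  | succ n ih => rw [stateLaw, stateLaw, ih fun i hi => h i (hi.trans n.lt_succ_self),
      h n n.lt_succ_self]

theorem act_some_apply (π : Policy A) (s : S) (a : A s) :
    act π (some s) (some ⟨s, a⟩) = π s a := by
  rw [act, PMF.map_apply]
  rw [tsum_eq_single a]
  · simp
  · intro b hb
    simp [Ne.symm hb]

theorem act_apply_some_of_ne (π : Policy A) {o : Option S} {p : Σ s, A s} (h : o ≠ some p.1) :
    act π o (some p) = 0 := by
  cases o with
  | none => simp [act]
  | some s =>
    rw [act, PMF.map_apply]
    refine ENNReal.tsum_eq_zero.2 fun a => if_neg ?_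
    rintro heq
    rw [Option.some.injEq] at heq
    exact h (by rw [heq])

theorem act_apply_none (π : Policy A) (o : Option S) [Decidable (o = none)] :
    act π o none = if o = none then 1 else 0 := by
  cases o with
  | none => simp [act]
  | some s => simp [act, PMF.map_apply]

theorem stepLaw_apply_some (M : SSP S A) (ρ : ℕ → Policy A) (n : ℕ) (o : Option S)
    (s : S) (a : A s) :
    M.stepLaw ρ n o (some ⟨s, a⟩) = M.stateLaw ρ n o (some s) * ρ n s a := by
  rw [stepLaw, PMF.bind_apply, tsum_eq_single (some s), act_some_apply]
  intro o' ho'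
  rw [act_apply_some_of_ne _ ho', mul_zero]

theorem stepLaw_apply_none (M : SSP S A) (ρ : ℕ → Policy A) (n : ℕ) (o : Option S) :
    M.stepLaw ρ n o none = M.stateLaw ρ n o none := by
  classical
  rw [stepLaw, PMF.bind_apply, tsum_eq_single none, act_apply_none, if_pos rfl, mul_one]
  intro o' ho'
  rw [act_apply_none, if_neg ho', mul_zero]

end StateLaw

/-! ### Marginals of the trajectory law -/

section TrajLaw

variable {S : Type u} [Fintype S] {A : S → Type v} [∀ s, Fintype (A s)]

instance (M : SSP S A) (ρ : ℕ → Policy A) (s : S) : IsProbabilityMeasure (M.trajLaw ρ s) := by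
  have : IsProbabilityMeasure (act (ρ 0) (some s)).toMeasure := PMF.toMeasure.isProbabilityMeasure _
  unfold trajLaw
  infer_instance

/-- The trajectory measure is built from kernels on histories, so composing its restriction to times
up to `n` with the next kernel gives the restriction up to `n + 1`. The kernel looks only at the
last step, which leaves a statement about two consecutive coordinates. -/
theorem trajLaw_pair (M : SSP S A) (ρ : ℕ → Policy A) (s : S) (n : ℕ) (B : Set (Step A × Step A)) :
    M.trajLaw ρ s {x | (x n, x (n + 1)) ∈ B} =
      ∫⁻ x, (M.step (ρ (n + 1)) (x n)).toMeasure {y | (x n, y) ∈ B} ∂(M.trajLaw ρ s) := by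
  have : IsProbabilityMeasure (act (ρ 0) (some s)).toMeasure := PMF.toMeasure.isProbabilityMeasure _
  have key := Kernel.map_frestrictLe_trajMeasure_compProd_eq_map_trajMeasure
    (X := fun _ => Step A) (μ₀ := (act (ρ 0) (some s)).toMeasure) (κ := M.stepKernel ρ) (a := n)
  change (M.trajLaw ρ s).map _ ⊗ₘ _ = (M.trajLaw ρ s).map _ at key
  let C : Set ((∀ _ : Finset.Iic n, Step A) × Step A) :=
    {z | (z.1 ⟨n, Finset.mem_Iic.2 le_rfl⟩, z.2) ∈ B}
  have hB : MeasurableSet B := B.to_countable.measurableSet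
  have hC : MeasurableSet C := by
    apply hB.preimage
    fun_prop
  have h1 := congrArg (fun ν => ν C) key
  rw [Measure.map_apply (by fun_prop) hC, Measure.compProd_apply hC,
    lintegral_map (Kernel.measurable_kernel_prodMk_left hC) (by fun_prop)] at h1
  exact h1.symm

theorem trajLaw_map_zero (M : SSP S A) (ρ : ℕ → Policy A) (s : S) :
    (M.trajLaw ρ s).map (fun x => x 0) = (act (ρ 0) (some s)).toMeasure := by
  have : IsProbabilityMeasure (act (ρ 0) (some s)).toMeasure := PMF.toMeasure.isProbabilityMeasure _
  have h0 : (fun x : ℕ → Step A => x 0) =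
      (fun z : ∀ _ : Finset.Iic 0, Step A => z ⟨0, Finset.mem_Iic.2 le_rfl⟩) ∘
        Preorder.frestrictLe (π := fun _ => Step A) 0 := rfl
  rw [h0, ← Measure.map_map (by fun_prop) (by fun_prop), trajLaw, Kernel.trajMeasure,
    Measure.map_comp _ _ (by fun_prop), Kernel.traj_map_frestrictLe, Kernel.partialTraj_self,
    Measure.id_comp, Measure.map_map (by fun_prop) (by fun_prop)]
  exact Measure.map_id

/-- The marginals of the law of the trajectory. -/
theorem trajLaw_eq (M : SSP S A) (ρ : ℕ → Policy A) (s : S) (n : ℕ) (y : Step A) :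
    M.trajLaw ρ s {x | x n = y} = M.stepLaw ρ n (some s) y := by
  induction n generalizing y with
  | zero =>
    have : M.trajLaw ρ s {x | x 0 = y} = ((M.trajLaw ρ s).map (fun x => x 0)) {y} := by
      rw [Measure.map_apply (measurable_pi_apply 0) (measurableSet_singleton _)]
      rfl
    rw [this, trajLaw_map_zero, PMF.toMeasure_apply_singleton _ _ (measurableSet_singleton _),
      stepLaw, stateLaw, PMF.pure_bind]
  | succ n ih =>
    have h := M.trajLaw_pair ρ s n {z | z.2 = y}
    simp only [Set.mem_ofPred_eq] at h
    rw [h, stepLaw_succ, PMF.bind_apply]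
    have h2 : ∀ z : Step A, (M.step (ρ (n + 1)) z).toMeasure {y' | y' = y} =
        M.step (ρ (n + 1)) z y := fun z => by
      rw [Set.ofPred_eq_eq_singleton, PMF.toMeasure_apply_singleton _ _ (measurableSet_singleton _)]
    simp_rw [h2]
    have hm : Measurable fun x : ℕ → Step A => x n := measurable_pi_apply n
    rw [← lintegral_map (f := fun z => M.step (ρ (n + 1)) z y) (g := fun x : ℕ → Step A => x n)
      (measurable_from_top) hm, lintegral_countable']
    refine tsum_congr fun z => ?_
    rw [Measure.map_apply hm (measurableSet_singleton _), mul_comm, ← ih z]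
    rfl

/-- Absorption is only almost sure: the path space also contains sequences that leave `none`, but
each transition gives them no mass. -/
theorem trajLaw_absorbing (M : SSP S A) (ρ : ℕ → Policy A) (s : S) :
    ∀ᵐ x ∂(M.trajLaw ρ s), ∀ n, x n = none → x (n + 1) = none := by
  rw [ae_all_iff]
  intro n
  have h := M.trajLaw_pair ρ s n {z | ¬ (z.1 = none → z.2 = none)}
  simp only [Set.mem_ofPred_eq] at h
  rw [ae_iff, h]
  refine (lintegral_congr fun x => ?_).trans lintegral_zero
  cases hx : x n with
  | none =>
    simp only [step, forall_true_left]
    rw [PMF.toMeasure_apply_eq_zero_iff _ (Set.to_countable _).measurableSet]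
    simp
  | some p => simp

end TrajLaw

end SSP

namespace SSP

/-! ### Survival probabilities and their exponential decay -/

section Survival

variable {S : Type u} [Fintype S] {A : S → Type v}

theorem toReal_bind_apply {α β : Type*} [Fintype α] (p : PMF α) (f : α → PMF β) (b : β) :
    ((p.bind f) b).toReal = ∑ a, (p a).toReal * (f a b).toReal := by
  rw [PMF.bind_apply, tsum_fintype, ENNReal.toReal_sum]
  · simp [ENNReal.toReal_mul]
  · exact fun a _ => ENNReal.mul_ne_top (p.apply_ne_top a) ((f a).apply_ne_top b)

theorem sum_toReal_pmf {α : Type*} [Fintype α] (p : PMF α) : ∑ a, (p a).toReal = 1 := by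
  rw [← ENNReal.toReal_sum fun a _ => p.apply_ne_top a, ← tsum_fintype (L := .unconditional α),
    p.tsum_coe, ENNReal.toReal_one]

/-- The probability that the goal is not reached at time `n`. -/
noncomputable def surv (M : SSP S A) (ρ : ℕ → Policy A) (n : ℕ) (o : Option S) : ℝ :=
  ∑ s, (M.stateLaw ρ n o (some s)).toReal

theorem surv_nonneg (M : SSP S A) (ρ : ℕ → Policy A) (n : ℕ) (o : Option S) :
    0 ≤ M.surv ρ n o :=
  Finset.sum_nonneg fun _ _ => ENNReal.toReal_nonneg

theorem surv_eq (M : SSP S A) (ρ : ℕ → Policy A) (n : ℕ) (o : Option S) :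
    M.surv ρ n o = 1 - (M.stateLaw ρ n o none).toReal := by
  have h := sum_toReal_pmf (M.stateLaw ρ n o)
  rw [Fintype.sum_option] at h
  rw [surv]
  linarith

theorem surv_le_one (M : SSP S A) (ρ : ℕ → Policy A) (n : ℕ) (o : Option S) :
    M.surv ρ n o ≤ 1 := by
  rw [surv_eq]
  linarith [ENNReal.toReal_nonneg (a := M.stateLaw ρ n o none)]

theorem surv_none (M : SSP S A) (ρ : ℕ → Policy A) (n : ℕ) : M.surv ρ n none = 0 := by
  simp [surv, stateLaw_none]

theorem surv_zero (M : SSP S A) (ρ : ℕ → Policy A) (s : S) : M.surv ρ 0 (some s) = 1 := by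
  rw [surv_eq]
  simp [stateLaw]

/-- Chapman–Kolmogorov summed over final states; starting from the goal contributes nothing. -/
theorem surv_add (M : SSP S A) (ρ : ℕ → Policy A) (m n : ℕ) (o : Option S) :
    M.surv ρ (m + n) o = ∑ s, (M.stateLaw ρ m o (some s)).toReal *
      M.surv (fun i => ρ (m + i)) n (some s) := by
  have h : ∑ s, (M.stateLaw ρ (m + n) o (some s)).toReal =
      ∑ s, ∑ o', (M.stateLaw ρ m o o').toReal *
        (M.stateLaw (fun i => ρ (m + i)) n o' (some s)).toReal :=
    Finset.sum_congr rfl fun s _ => by rw [stateLaw_add, toReal_bind_apply]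
  rw [surv, h, Finset.sum_comm, Fintype.sum_option]
  simp only [← Finset.mul_sum]
  change _ * M.surv (fun i => ρ (m + i)) n none + _ = _
  rw [surv_none, mul_zero, zero_add]
  rfl

theorem surv_add_le (M : SSP S A) (ρ : ℕ → Policy A) (m n : ℕ) (o : Option S) :
    M.surv ρ (m + n) o ≤ M.surv ρ m o := by
  rw [surv_add]
  exact Finset.sum_le_sum fun s _ =>
    mul_le_of_le_one_right ENNReal.toReal_nonneg (surv_le_one _ _ _ _)

theorem surv_antitone (M : SSP S A) (ρ : ℕ → Policy A) (o : Option S) :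
    Antitone fun n => M.surv ρ n o := by
  intro m n hmn
  obtain ⟨k, rfl⟩ := Nat.exists_eq_add_of_le hmn
  exact M.surv_add_le ρ m k o

theorem surv_congr (M : SSP S A) {ρ ρ' : ℕ → Policy A} (n : ℕ) (h : ∀ i < n, ρ i = ρ' i)
    (o : Option S) : M.surv ρ n o = M.surv ρ' n o := by
  simp only [surv, M.stateLaw_congr n h]

/-- A bound on the sums of tails, from a bound on the survival probabilities of one block. -/
theorem sum_surv_le (M : SSP S A) (π : Policy A) {N : ℕ}
    (hN : ∀ s, M.surv (fun _ => π) N (some s) ≤ 1 / 2) (n : ℕ) (s : S) :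
    ∑ j ∈ Finset.range n, M.surv (fun _ => π) j (some s) ≤ 2 * N := by
  have : Nonempty S := ⟨s⟩
  -- For a state `t` with the largest partial sum `F t`, the first `N` terms cost at most `N` and
  -- the shifted ones at most `F t / 2`, so `F t ≤ 2 * N`.
  obtain ⟨t, ht⟩ := Finite.exists_max
    fun t => ∑ j ∈ Finset.range n, M.surv (fun _ => π) j (some t)
  set F : S → ℝ := fun t => ∑ j ∈ Finset.range n, M.surv (fun _ => π) j (some t) with hF
  have h1 : F t ≤ N + ∑ j ∈ Finset.range n, M.surv (fun _ => π) (N + j) (some t) := by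
    calc F t ≤ ∑ j ∈ Finset.range (N + n), M.surv (fun _ => π) j (some t) :=
          Finset.sum_le_sum_of_subset_of_nonneg
            (Finset.range_mono (Nat.le_add_left _ _)) fun _ _ _ => surv_nonneg _ _ _ _
      _ = _ := Finset.sum_range_add _ _ _
      _ ≤ _ := by
          gcongr
          refine (Finset.sum_le_card_nsmul _ _ 1 fun _ _ => surv_le_one _ _ _ _).trans ?_
          simp
  have h2 : ∑ j ∈ Finset.range n, M.surv (fun _ => π) (N + j) (some t) ≤ F t * (1 / 2) := by
    simp only [surv_add]
    rw [Finset.sum_comm]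
    simp only [← Finset.mul_sum]
    calc _ ≤ ∑ i, (M.stateLaw (fun _ => π) N (some t) (some i)).toReal * F t :=
          Finset.sum_le_sum fun i _ => mul_le_mul_of_nonneg_left (ht i) ENNReal.toReal_nonneg
      _ = F t * M.surv (fun _ => π) N (some t) := by rw [← Finset.sum_mul, mul_comm]; rfl
      _ ≤ _ := mul_le_mul_of_nonneg_left (hN t)
          (Finset.sum_nonneg fun _ _ => surv_nonneg _ _ _ _)
  exact (ht s).trans (by linarith)

section Tail

variable (M : SSP S A) (π : Policy A) {D : ℝ}
  (hs : ∀ s, Summable fun n => M.surv (fun _ => π) n (some s))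
  (hD : ∀ s, ∑' n, M.surv (fun _ => π) n (some s) ≤ D)

include hs in
theorem summable_surv (n : ℕ) (o : Option S) : Summable fun j => M.surv (fun _ => π) (n + j) o := by
  cases o with
  | none => simp [surv_none]
  | some s =>
    have := (summable_nat_add_iff n).2 (hs s)
    simpa [add_comm] using this

-- By the Markov property, from any state occupied at time `n` the expected remaining number of
-- steps is at most `D`.
include hs hD in
theorem tsum_surv_le_mul (n : ℕ) (o : Option S) :
    ∑' j, M.surv (fun _ => π) (n + j) o ≤ D * M.surv (fun _ => π) n o := by
  simp only [surv_add]
  rw [Summable.tsum_finsetSum fun s _ => (hs s).mul_left _]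
  simp only [tsum_mul_left]
  rw [surv, Finset.mul_sum]
  refine Finset.sum_le_sum fun s _ => ?_
  rw [mul_comm D]
  exact mul_le_mul_of_nonneg_left (hD s) ENNReal.toReal_nonneg

include hs hD in
/-- The expected number of steps after time `n` decays exponentially. -/
theorem tsum_surv_le (hD1 : 1 ≤ D) (n : ℕ) (o : Option S) :
    ∑' j, M.surv (fun _ => π) (n + j) o ≤ D * Real.exp (-n / D) := by
  have hD0 : 0 < D := by linarith
  induction n with
  | zero =>
    cases o with
    | none => simp [surv_none, hD0.le]
    | some s => simpa using hD s
  | succ n ih =>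
    have h1 := M.tsum_surv_le_mul π hs hD n o
    have h2 := (M.summable_surv π hs n o).tsum_eq_zero_add
    have h3 : (fun j => M.surv (fun _ => π) (n + (j + 1)) o) =
        fun j => M.surv (fun _ => π) (n + 1 + j) o := funext fun j => by ring_nf
    rw [h3, add_zero] at h2
    set U := ∑' j, M.surv (fun _ => π) (n + j) o
    have hU : 0 ≤ U := tsum_nonneg fun _ => surv_nonneg _ _ _ _
    -- The tail loses its first term, which is at least the fraction `1 / D` of the tail.
    have h4 : ∑' j, M.surv (fun _ => π) (n + 1 + j) o ≤ (1 - 1 / D) * U := by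
      have : U / D ≤ M.surv (fun _ => π) n o := by rwa [div_le_iff₀' hD0]
      rw [sub_mul, one_mul, one_div_mul_eq_div]
      linarith
    refine h4.trans ?_
    have h5 : 1 - 1 / D ≤ Real.exp (-1 / D) := by
      have := Real.add_one_le_exp (-1 / D)
      rw [neg_div] at *
      linarith
    calc (1 - 1 / D) * U ≤ Real.exp (-1 / D) * (D * Real.exp (-n / D)) := by
          gcongr
      _ = D * (Real.exp (-n / D) * Real.exp (-1 / D)) := by ring
      _ = _ := by
          rw [← Real.exp_add]
          push_cast
          ring_nf

-- By monotonicity, the `⌊D⌋ + 1 > D` survival probabilities at times `n - ⌊D⌋, …, n` are all at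
-- least the last one, so `D` times it is at most the tail sum from `n - ⌊D⌋`. Dividing by `D`
-- removes the prefactor of the tail bound; the shift by `⌊D⌋` costs a factor `e`. For `n ≤ ⌊D⌋` the
-- bound is at least `1`.
include hs hD in
theorem surv_le_exp (hD1 : 1 ≤ D) (n : ℕ) (o : Option S) :
    M.surv (fun _ => π) n o ≤ Real.exp (1 - n / D) := by
  have hD0 : 0 < D := by linarith
  have hm1 : (⌊D⌋₊ : ℝ) ≤ D := Nat.floor_le hD0.le
  have hm2 : D < ⌊D⌋₊ + 1 := Nat.lt_floor_add_one D
  generalize ⌊D⌋₊ = m at hm1 hm2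
  rcases le_total m n with hmn | hmn
  · obtain ⟨k, rfl⟩ := Nat.exists_eq_add_of_le hmn
    have h1 := M.tsum_surv_le π hs hD hD1 k o
    have h2 : (m + 1) * M.surv (fun _ => π) (m + k) o ≤ ∑' j, M.surv (fun _ => π) (k + j) o := by
      refine le_trans ?_ ((M.summable_surv π hs k o).sum_le_tsum (Finset.range (m + 1))
        fun _ _ => surv_nonneg _ _ _ _)
      have := Finset.card_nsmul_le_sum (Finset.range (m + 1))
        (fun j => M.surv (fun _ => π) (k + j) o) (M.surv (fun _ => π) (m + k) o) fun j hj =>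
          M.surv_antitone _ o (by rw [Finset.mem_range] at hj; omega)
      simpa using this
    have h3 : D * M.surv (fun _ => π) (m + k) o ≤ D * Real.exp (-k / D) :=
      le_trans (mul_le_mul_of_nonneg_right hm2.le (surv_nonneg _ _ _ _)) (h2.trans h1)
    refine (le_of_mul_le_mul_left h3 hD0).trans (Real.exp_le_exp.2 ?_)
    push_cast
    rw [add_div, neg_div]
    have : (m : ℝ) / D ≤ 1 := (div_le_one hD0).2 hm1
    linarith
  · refine (surv_le_one _ _ _ _).trans (Real.one_le_exp ?_)
    have : (n : ℝ) / D ≤ 1 := (div_le_one hD0).2 ((Nat.cast_le.2 hmn).trans hm1)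
    linarith

end Tail

end Survival

/-! ### Hitting times and the diameter -/

section HitTime

variable {S : Type u} [Fintype S] {A : S → Type v} [∀ s, Fintype (A s)]

theorem measurableSet_coord (n : ℕ) (B : Set (Step A)) :
    MeasurableSet {x : ℕ → Step A | x n ∈ B} :=
  measurable_pi_apply n B.to_countable.measurableSet

theorem trajLaw_ne_none (M : SSP S A) (ρ : ℕ → Policy A) (s : S) (n : ℕ) :
    M.trajLaw ρ s {x | x n ≠ none} = ENNReal.ofReal (M.surv ρ n (some s)) := by
  have h : {x : ℕ → Step A | x n ≠ none} = {x | x n = none}ᶜ := rfl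
  rw [h, prob_compl_eq_one_sub (show MeasurableSet {x : ℕ → Step A | x n = none} from
    measurableSet_coord n {none}), trajLaw_eq, stepLaw_apply_none,
    surv_eq, ENNReal.ofReal_sub _ ENNReal.toReal_nonneg, ENNReal.ofReal_one,
    ENNReal.ofReal_toReal (PMF.apply_ne_top _ _)]

theorem lintegral_numSteps (M : SSP S A) (ρ : ℕ → Policy A) (s : S) :
    ∫⁻ x, numSteps x ∂(M.trajLaw ρ s) = ∑' n, ENNReal.ofReal (M.surv ρ n (some s)) := by
  classical
  unfold numSteps
  rw [lintegral_tsum]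
  · refine tsum_congr fun n => ?_
    rw [← trajLaw_ne_none, ← lintegral_indicator_one
      (show MeasurableSet {x : ℕ → Step A | x n ≠ none} from measurableSet_coord n {y | y ≠ none})]
    refine lintegral_congr fun x => ?_
    by_cases hx : x n = none <;> simp [Set.indicator, hx]
  · exact fun n => (Measurable.ite (measurableSet_coord n {none}) measurable_const
      measurable_const).aemeasurable

/-- Almost sure absorption makes each survival probability tend to `0`. As there are finitely many
states, some common `N` brings all of them below `1 / 2`, and `sum_surv_le` bounds the partial sums.
So proper policies have finite expected hitting times. -/
theorem summable_of_proper (M : SSP S A) {π : Policy A} (h : M.Proper π) (s : S) :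
    Summable fun n => M.surv (fun _ => π) n (some s) := by
  have hlim : ∀ s, Filter.Tendsto (fun n => M.surv (fun _ => π) n (some s)) Filter.atTop
      (nhds 0) := by
    intro s
    have hE : ∀ n, M.trajLaw (fun _ => π) s {x | ∀ i ≤ n, x i ≠ none} =
        ENNReal.ofReal (M.surv (fun _ => π) n (some s)) := by
      intro n
      rw [← trajLaw_ne_none]
      refine measure_congr ?_
      filter_upwards [M.trajLaw_absorbing (fun _ => π) s] with x hx
      refine propext ⟨fun hn => hn n le_rfl, fun hn i hi hxi => hn ?_⟩
      exact Nat.le_induction hxi (fun k _ hk => hx k hk) n hi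
    have h1 := tendsto_measure_iInter_atTop (μ := M.trajLaw (fun _ => π) s)
      (s := fun n => {x : ℕ → Step A | ∀ i ≤ n, x i ≠ none})
      (fun n => by
        have : {x : ℕ → Step A | ∀ i ≤ n, x i ≠ none} = ⋂ i, ⋂ _ : i ≤ n, {x | x i ≠ none} := by
          ext x; simp
        rw [this]
        exact (MeasurableSet.iInter fun i => MeasurableSet.iInter fun _ =>
          measurableSet_coord i {y | y ≠ none}).nullMeasurableSet)
      (fun m n hmn x hx i hi => hx i (hi.trans hmn)) ⟨0, measure_ne_top _ _⟩
    have h2 : M.trajLaw (fun _ => π) s (⋂ n, {x : ℕ → Step A | ∀ i ≤ n, x i ≠ none}) = 0 := by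
      refine measure_mono_null (fun x hx => ?_) (ae_iff.1 (h s))
      rw [Set.mem_iInter] at hx
      rintro ⟨i, hi⟩
      exact hx i i le_rfl hi
    rw [h2] at h1
    simp only [Function.comp_def, hE] at h1
    have h3 := (ENNReal.tendsto_toReal ENNReal.zero_ne_top).comp h1
    simpa [Function.comp_def, ENNReal.toReal_ofReal (surv_nonneg _ _ _ _)] using h3
  have hN : ∃ N, ∀ s, M.surv (fun _ => π) N (some s) ≤ 1 / 2 := by
    have : ∀ᶠ N in Filter.atTop, ∀ s, M.surv (fun _ => π) N (some s) ≤ 1 / 2 :=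
      Filter.eventually_all.2 fun s => (hlim s).eventually (ge_mem_nhds (by norm_num))
    exact this.exists
  obtain ⟨N, hN⟩ := hN
  exact summable_of_sum_range_le (fun n => surv_nonneg _ _ _ _)
    fun n => M.sum_surv_le π hN n s

theorem hitTime_eq (M : SSP S A) {π : Policy A} (h : M.Proper π) (s : S) :
    M.hitTime π s = ENNReal.ofReal (∑' n, M.surv (fun _ => π) n (some s)) := by
  rw [hitTime, lintegral_numSteps, ENNReal.ofReal_tsum_of_nonneg (fun n => surv_nonneg _ _ _ _)
    (M.summable_of_proper h s)]

theorem tsum_surv_le_maxHitTime (M : SSP S A) {π : Policy A} (h : M.Proper π) (s : S) :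
    ∑' n, M.surv (fun _ => π) n (some s) ≤ M.maxHitTime π := by
  rw [maxHitTime, ← ENNReal.ofReal_le_iff_le_toReal, ← hitTime_eq M h]
  · exact le_iSup (fun s => M.hitTime π s) s
  -- Finiteness of the supremum matters: `toReal` would send `∞` to `0`.
  · have : Nonempty S := ⟨s⟩
    exact iSup_ne_top fun s => by rw [hitTime_eq M h]; exact ENNReal.ofReal_ne_top

theorem one_le_maxHitTime (M : SSP S A) {π : Policy A} (h : M.Proper π) :
    1 ≤ M.maxHitTime π := by
  refine le_trans ?_ (M.tsum_surv_le_maxHitTime h M.init)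
  rw [← M.surv_zero (fun _ => π) M.init]
  exact (M.summable_of_proper h M.init).le_tsum 0 fun _ _ => surv_nonneg _ _ _ _

/-- A fast policy attains the infimum at every state simultaneously, so the decay estimates hold for
it with the diameter as rate. -/
theorem diameter_eq (M : SSP S A) {π : ∀ s, A s} (h : M.IsFast π) :
    M.diameter = M.maxHitTime (detPolicy π) := by
  rw [diameter, maxHitTime]
  congr 1
  refine iSup_congr fun s => le_antisymm ?_ ?_
  · exact (iInf_le _ π).trans (iInf_le _ h.1)
  · exact le_iInf fun π' => le_iInf fun h' => h.2 π' h' s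

end HitTime

end SSP

namespace LoopFree

/-! ### Loop-free costs along a single trajectory -/

section Layers

variable {S : Type u} {A : S → Type v}

/-- The value of `g` at the triple of layer `h` that is visited by the trajectory `x`, and `0` if
there is no such triple. -/
def layerVal (H₁ H₂ : ℕ) (x : ℕ → Step A) (g : Triple A (H₁ + H₂) → ℝ) (h : Fin (H₁ + H₂)) : ℝ :=
  if h.1 < H₁ then
    match x h.1 with
    | none => 0
    | some p => g ⟨(Sum.inl p.1, h), p.2⟩
  else
    match x (H₁ - 1) with
    | none => 0
    | some _ => g ⟨(Sum.inr (), h), PUnit.unit⟩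

theorem layerVal_layerMul (H₁ H₂ : ℕ) (x : ℕ → Step A) (g : Triple A (H₁ + H₂) → ℝ)
    (h : Fin (H₁ + H₂)) :
    layerVal H₁ H₂ x (layerMul g) h = ((h : ℝ) + 1) * layerVal H₁ H₂ x g h := by
  unfold layerVal
  split_ifs
  · cases x h.1 <;> simp [layerMul]
  · cases x (H₁ - 1) <;> simp [layerMul]

variable {c : (Σ s, A s) → ℝ}

theorem cost_nonneg {H : ℕ} (hc : ∀ p, 0 ≤ c p) (p : Triple A H) : 0 ≤ cost c p := by
  obtain ⟨⟨s | s, h⟩, a⟩ := p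
  · exact hc _
  · exact zero_le_one

theorem cost_le_one {H : ℕ} (hc : ∀ p, c p ≤ 1) (p : Triple A H) : cost c p ≤ 1 := by
  obtain ⟨⟨s | s, h⟩, a⟩ := p
  · exact hc _
  · exact le_rfl

theorem layerVal_mem (H₁ H₂ : ℕ) (x : ℕ → Step A) {g : Triple A (H₁ + H₂) → ℝ}
    (hg : ∀ p, 0 ≤ g p ∧ g p ≤ 1) (h : Fin (H₁ + H₂)) :
    0 ≤ layerVal H₁ H₂ x g h ∧ layerVal H₁ H₂ x g h ≤ 1 := by
  unfold layerVal
  split_ifs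
  · cases x h.1
    · simp
    · exact hg _
  · cases x (H₁ - 1)
    · simp
    · exact hg _

/-- All `H₂` layers after `H₁` charge `1` under the same condition: the goal is not reached at step
`H₁`, which is index `H₁ - 1`. -/
theorem sum_layerVal_cost (H₁ H₂ : ℕ) (x : ℕ → Step A) (c : (Σ s, A s) → ℝ) :
    ∑ h, layerVal H₁ H₂ x (cost c) h =
      ∑ i ∈ Finset.range H₁, SSP.stepCost c (x i) +
        H₂ * SSP.stepCost (fun _ => 1) (x (H₁ - 1)) := by
  rw [Fin.sum_univ_add, ← Fin.sum_univ_eq_sum_range (fun i => SSP.stepCost c (x i))]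
  congr 1
  · refine Finset.sum_congr rfl fun i _ => ?_
    simp only [layerVal, Fin.val_castAdd, i.2, if_true]
    cases x i <;> rfl
  · have : ∀ i : Fin H₂, layerVal H₁ H₂ x (cost c) (Fin.natAdd H₁ i) =
        SSP.stepCost (fun _ => 1) (x (H₁ - 1)) := by
      intro i
      simp only [layerVal, Fin.val_natAdd, not_lt.2 (Nat.le_add_right H₁ i), if_false]
      cases x (H₁ - 1) <;> rfl
    simp [this]

/-- Adding `y n` raises the square by `2 * y n * ∑ y i + y n ^ 2 ≤ (2 * n + 1) * y n`, which is
below the increment `2 * (n + 1) * y n` on the right. This is where the layer weights of $\vec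
h\circ c$ come from: they bound a second moment by a linear functional of the visits. -/
theorem sq_sum_le {y : ℕ → ℝ} (hy : ∀ i, 0 ≤ y i ∧ y i ≤ 1) (n : ℕ) :
    (∑ i ∈ Finset.range n, y i) ^ 2 ≤ 2 * ∑ i ∈ Finset.range n, ((i : ℝ) + 1) * y i := by
  induction n with
  | zero => simp
  | succ n ih =>
    rw [Finset.sum_range_succ, Finset.sum_range_succ]
    have h1 : ∑ i ∈ Finset.range n, y i ≤ n := by
      simpa using Finset.sum_le_card_nsmul (Finset.range n) y 1 fun i _ => (hy i).2
    have h2 := mul_le_mul_of_nonneg_right h1 (hy n).1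
    have h3 := mul_le_mul_of_nonneg_right (hy n).2 (hy n).1
    have h4 := (hy n).1
    nlinarith

theorem sq_sum_layerVal_le (H₁ H₂ : ℕ) (x : ℕ → Step A) {g : Triple A (H₁ + H₂) → ℝ}
    (hg : ∀ p, 0 ≤ g p ∧ g p ≤ 1) :
    (∑ h, layerVal H₁ H₂ x g h) ^ 2 ≤ 2 * ∑ h, layerVal H₁ H₂ x (layerMul g) h := by
  let y : ℕ → ℝ := fun i => if hi : i < H₁ + H₂ then layerVal H₁ H₂ x g ⟨i, hi⟩ else 0
  have hy : ∀ i, 0 ≤ y i ∧ y i ≤ 1 := by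
    intro i
    simp only [y]
    split_ifs
    · exact layerVal_mem H₁ H₂ x hg _
    · simp
  have h1 : ∀ h : Fin (H₁ + H₂), layerVal H₁ H₂ x g h = y h := fun h => by simp [y]
  simp only [layerVal_layerMul, h1]
  rw [Fin.sum_univ_eq_sum_range y, Fin.sum_univ_eq_sum_range fun i => ((i : ℝ) + 1) * y i]
  exact sq_sum_le hy _

variable [Fintype S] [∀ s, Fintype (A s)]

theorem sum_triple {H : ℕ} (f : Triple A H → ℝ) :
    ∑ p, f p = ∑ h, (∑ p : Σ s, A s, f ⟨(Sum.inl p.1, h), p.2⟩ +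
      f ⟨(Sum.inr (), h), PUnit.unit⟩) := by
  rw [Fintype.sum_sigma, Fintype.sum_prod_type_right]
  refine Finset.sum_congr rfl fun h _ => ?_
  rw [Fintype.sum_sum_type, Fintype.sum_sigma]
  congr 1
  rw [Fintype.sum_unique]
  exact Fintype.sum_unique (ι := PUnit) (fun a => f ⟨(Sum.inr (), h), a⟩)

/-- A trajectory visits at most one triple of each layer. -/
theorem pairing_visits (H₁ H₂ : ℕ) (x : ℕ → Step A) (g : Triple A (H₁ + H₂) → ℝ) :
    pairing (visits H₁ H₂ x) g = ∑ h, layerVal H₁ H₂ x g h := by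
  classical
  rw [pairing, sum_triple]
  refine Finset.sum_congr rfl fun h _ => ?_
  unfold layerVal
  by_cases hh : h.1 < H₁
  · simp only [visits, hh, true_and, if_true, not_le.2 hh, false_and, if_false, zero_mul, add_zero]
    cases hx : x h.1 with
    | none => simp
    | some p =>
      rw [Finset.sum_eq_single p]
      · simp
      · intro q _ hq
        simp [Ne.symm hq]
      · simp
  · simp only [visits, hh, false_and, if_false, zero_mul, Finset.sum_const_zero, zero_add,
      not_lt.1 hh, true_and]
    cases hx : x (H₁ - 1) <;> simp

theorem pairing_visits_cost (H₁ H₂ : ℕ) (x : ℕ → Step A) (c : (Σ s, A s) → ℝ) :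
    pairing (visits H₁ H₂ x) (cost c) =
      ∑ i ∈ Finset.range H₁, SSP.stepCost c (x i) +
        H₂ * SSP.stepCost (fun _ => 1) (x (H₁ - 1)) := by
  rw [pairing_visits, sum_layerVal_cost]

theorem sq_pairing_visits_le (H₁ H₂ : ℕ) (x : ℕ → Step A) {g : Triple A (H₁ + H₂) → ℝ}
    (hg : ∀ p, 0 ≤ g p ∧ g p ≤ 1) :
    pairing (visits H₁ H₂ x) g ^ 2 ≤ 2 * pairing (visits H₁ H₂ x) (layerMul g) := by
  simpa only [pairing_visits] using sq_sum_layerVal_le H₁ H₂ x hg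

theorem pairing_visits_mem (H₁ H₂ : ℕ) (x : ℕ → Step A) {g : Triple A (H₁ + H₂) → ℝ}
    (hg : ∀ p, 0 ≤ g p ∧ g p ≤ 1) :
    0 ≤ pairing (visits H₁ H₂ x) g ∧ pairing (visits H₁ H₂ x) g ≤ (H₁ + H₂ : ℕ) := by
  rw [pairing_visits]
  refine ⟨Finset.sum_nonneg fun h _ => (layerVal_mem H₁ H₂ x hg h).1, ?_⟩
  simpa using Finset.sum_le_card_nsmul Finset.univ (layerVal H₁ H₂ x g) 1
    fun h _ => (layerVal_mem H₁ H₂ x hg h).2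

end Layers

/-! ### Loop-free occupancy measures from trajectories of the MDP -/

section Occupancy

variable {S : Type u} {A : S → Type v}

/-- The set of trajectories that visit a triple. -/
def visitSet (H₁ H₂ : ℕ) : Triple A (H₁ + H₂) → Set (ℕ → Step A)
  | ⟨(Sum.inl s, h), a⟩ => {x | h.1 < H₁ ∧ x h.1 = some ⟨s, a⟩}
  | ⟨(Sum.inr _, h), _⟩ => {x | H₁ ≤ h.1 ∧ x (H₁ - 1) ≠ none}

theorem visits_eq_indicator (H₁ H₂ : ℕ) (x : ℕ → Step A) (p : Triple A (H₁ + H₂)) :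
    visits H₁ H₂ x p = (visitSet H₁ H₂ p).indicator 1 x := by
  by_cases hx : x ∈ visitSet H₁ H₂ p
  · rw [Set.indicator_of_mem hx]
    obtain ⟨⟨s | s, h⟩, a⟩ := p <;> exact if_pos hx
  · rw [Set.indicator_of_notMem hx]
    obtain ⟨⟨s | s, h⟩, a⟩ := p <;> exact if_neg hx

/-- The state of the loop-free instance at time `i` that corresponds to a state of the MDP. -/
def embed (H₁ H₂ i : ℕ) (o : Option S) : Option (State S (H₁ + H₂)) :=
  if hi : i < H₁ + H₂ then
    o.map fun s => (if i < H₁ then Sum.inl s else Sum.inr (), ⟨i, hi⟩)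
  else none

theorem embed_none (H₁ H₂ i : ℕ) : embed H₁ H₂ i (none : Option S) = none := by
  simp [embed]

theorem embed_some_of_lt {H₁ H₂ i : ℕ} (hi : i < H₁) (s : S) :
    embed H₁ H₂ i (some s) = some (Sum.inl s, ⟨i, Nat.lt_add_right H₂ hi⟩) := by
  simp [embed, hi, Nat.lt_add_right H₂ hi]

theorem embed_some_of_le {H₁ H₂ i : ℕ} (hi : H₁ ≤ i) (hi' : i < H₁ + H₂) (s : S) :
    embed H₁ H₂ i (some s) = some (Sum.inr (), ⟨i, hi'⟩) := by
  simp [embed, hi', not_lt.2 hi]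

theorem embed_of_le {H₁ H₂ i : ℕ} (hi : H₁ + H₂ ≤ i) (o : Option S) :
    embed H₁ H₂ i o = none := by
  simp [embed, not_lt.2 hi]

theorem embed_layer {H₁ H₂ i : ℕ} {o : Option S} {t : State S (H₁ + H₂)}
    (h : embed H₁ H₂ i o = some t) : t.2.1 = i := by
  unfold embed at h
  split_ifs at h
  all_goals
    cases o with
    | none => simp at h
    | some s =>
      simp only [Option.map_some, Option.some.injEq] at h
      rw [← h]

theorem nextFast_eq_embed {H₁ H₂ i : ℕ} (hi : H₁ ≤ i + 1) (hi' : i < H₁ + H₂) (s : S) :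
    nextFast (⟨i, hi'⟩ : Fin (H₁ + H₂)) = embed H₁ H₂ (i + 1) (some s) := by
  by_cases h : i + 1 < H₁ + H₂
  · rw [embed_some_of_le hi h, nextFast, dif_pos h]
  · rw [embed_of_le (not_lt.1 h), nextFast, dif_neg h]

/-- Up to layer `H₁` the two chains have the same transitions. From index `H₁ - 1` on the loop-free
chain moves deterministically, so it remembers only whether the goal was reached by then; hence the
time is frozen at `min i (H₁ - 1)`. -/
theorem stateLaw_inst (M : SSP S A) (H₁ H₂ : ℕ) (h₁ : 0 < H₁) (πf : ∀ s, A s)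
    (π : Policy (Action A (H₁ + H₂))) (i : ℕ) :
    (inst M H₁ H₂ h₁).stateLaw (fun _ => π) i (some (inst M H₁ H₂ h₁).init) =
      (M.stateLaw (sigma H₁ H₂ πf π) (min i (H₁ - 1)) (some M.init)).map (embed H₁ H₂ i) := by
  induction i with
  | zero =>
    rw [Nat.zero_min, SSP.stateLaw, SSP.stateLaw, PMF.pure_map, embed_some_of_lt h₁]
    rfl
  | succ i ih =>
    rw [SSP.stateLaw, ih, PMF.bind_map]
    by_cases hi : i + 1 < H₁
    · rw [show min i (H₁ - 1) = i by omega, show min (i + 1) (H₁ - 1) = i + 1 by omega,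
        SSP.stateLaw, PMF.map_bind]
      refine congrArg _ (funext fun o => ?_)
      cases o with
      | none => simp [embed_none, SSP.act, SSP.move, PMF.pure_map]
      | some s =>
        have hi' : i < H₁ := by omega
        have hs : sigma H₁ H₂ πf π i s = π (Sum.inl s, ⟨i, Nat.lt_add_right H₂ hi'⟩) := dif_pos hi'
        rw [Function.comp_apply, embed_some_of_lt hi', SSP.act_bind_move, SSP.act_bind_move]
        refine Eq.trans ?_ ((congrArg (fun q : PMF (A s) => (q.bind (M.P s)).map
          (embed H₁ H₂ (i + 1))) hs).trans (PMF.map_bind _ _ _)).symm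
        refine congrArg _ (funext fun a => ?_)
        refine (dif_pos hi).trans (congrArg (fun f => (M.P s a).map f) (funext fun o => ?_))
        cases o with
        | none => rw [embed_none]; rfl
        | some s' => rw [embed_some_of_lt hi]; rfl
    -- Both sides now push forward the same law, at index `H₁ - 1`, and it remains to compare
    -- deterministic maps.
    · rw [show min i (H₁ - 1) = H₁ - 1 by omega, show min (i + 1) (H₁ - 1) = H₁ - 1 by omega,
        ← PMF.bind_pure_comp]
      refine congrArg _ (funext fun o => ?_)
      rw [Function.comp_apply, Function.comp_apply]
      by_cases hH : i < H₁ + H₂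
      · cases o with
        | none => simp [embed_none, SSP.act, SSP.move]
        | some s =>
          rw [← nextFast_eq_embed (not_lt.1 hi) hH s]
          -- If `i < H₁`, then `i = H₁ - 1`: an action is still drawn from `π`, but the transition
          -- ignores it.
          by_cases hi' : i < H₁
          · rw [embed_some_of_lt hi', SSP.act_bind_move]
            exact (congrArg _ (funext fun a => dif_neg hi)).trans (PMF.bind_const _ _)
          · rw [embed_some_of_le (not_lt.1 hi') hH, SSP.act_bind_move]
            exact PMF.bind_const _ _
      · rw [embed_of_le (not_lt.1 hH), embed_of_le (by omega)]
        simp [SSP.act, SSP.move]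

variable [Fintype S] [∀ s, Fintype (A s)]

theorem measurableSet_visitSet (H₁ H₂ : ℕ) (p : Triple A (H₁ + H₂)) :
    MeasurableSet (visitSet H₁ H₂ p) := by
  obtain ⟨⟨s | s, h⟩, a⟩ := p
  · exact (MeasurableSet.const _).inter (SSP.measurableSet_coord _ {some ⟨s, a⟩})
  · exact (MeasurableSet.const _).inter (SSP.measurableSet_coord _ {y | y ≠ none})

theorem occ_eq_tsum (M : SSP S A) (π : Policy A) (p : Σ s, A s) :
    M.occ π p = (∑' i, M.stateLaw (fun _ => π) i (some M.init) (some p.1) * π p.1 p.2).toReal := by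
  classical
  rw [SSP.occ]
  unfold SSP.visits
  rw [lintegral_tsum]
  · congr 2
    funext i
    rw [← SSP.stepLaw_apply_some, ← SSP.trajLaw_eq, ← lintegral_indicator_one
      (show MeasurableSet {x : ℕ → Step A | x i = some ⟨p.1, p.2⟩} from
        SSP.measurableSet_coord i {some p})]
    refine lintegral_congr fun x => ?_
    rw [Set.indicator_apply]
    rfl
  · exact fun n => (Measurable.ite (SSP.measurableSet_coord n {some p}) measurable_const
      measurable_const).aemeasurable

/-- The occupancy measure of the loop-free instance is given by the trajectories of the MDP. -/
theorem occ_eq (M : SSP S A) (H₁ H₂ : ℕ) (h₁ : 0 < H₁) (πf : ∀ s, A s)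
    (π : Policy (Action A (H₁ + H₂))) (p : Triple A (H₁ + H₂)) :
    occ M H₁ H₂ h₁ π p = (M.trajLaw (sigma H₁ H₂ πf π) M.init).real (visitSet H₁ H₂ p) := by
  classical
  rw [occ, occ_eq_tsum, measureReal_def]
  congr 1
  have hmap : ∀ i, (inst M H₁ H₂ h₁).stateLaw (fun _ => π) i (some (inst M H₁ H₂ h₁).init)
      (some p.1) = ∑ o, if some p.1 = embed H₁ H₂ i o then
        M.stateLaw (sigma H₁ H₂ πf π) (min i (H₁ - 1)) (some M.init) o else 0 := by
    intro i
    rw [stateLaw_inst M H₁ H₂ h₁ πf π i, PMF.map_apply, tsum_fintype]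
    exact Finset.sum_congr rfl fun o _ => by congr
  -- A triple of a given layer can be occupied only at the time equal to that layer's index.
  rw [tsum_eq_single p.1.2.1, hmap]
  · obtain ⟨⟨s | s, h⟩, a⟩ := p
    · by_cases hh : h.1 < H₁
      · have e2 : visitSet H₁ H₂ ⟨(Sum.inl s, h), a⟩ =
            {x | x h.1 = some (⟨s, a⟩ : Σ s, A s)} :=
          Set.ext fun x => and_iff_right hh
        have e3 : sigma H₁ H₂ πf π h.1 s = π (Sum.inl s, h) := dif_pos hh
        refine Eq.trans ?_ (((congrArg _ e2).trans (M.trajLaw_eq _ M.init h.1 _)).trans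
          (M.stepLaw_apply_some _ h.1 (some M.init) s a)).symm
        refine congrArg₂ (· * ·) ?_ (congrArg (fun q : PMF (A s) => q a) e3.symm)
        change ∑ o, (if some (Sum.inl s, h) = embed H₁ H₂ h.1 o then
          M.stateLaw (sigma H₁ H₂ πf π) (min h.1 (H₁ - 1)) (some M.init) o else 0) = _
        rw [Fintype.sum_option, show min h.1 (H₁ - 1) = h.1 by omega]
        simp [embed_none, embed_some_of_lt hh]
      · have e2 : visitSet H₁ H₂ ⟨(Sum.inl s, h), a⟩ = ∅ :=
          Set.eq_empty_of_forall_notMem fun x hx => hh hx.1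
        rw [e2, measure_empty, Finset.sum_eq_zero, zero_mul]
        intro o _
        refine if_neg fun h' => ?_
        cases o with
        | none => simp [embed_none] at h'
        | some s' => simp [embed_some_of_le (not_lt.1 hh) h.2] at h'
    · have ha : π (Sum.inr s, h) a = 1 := by
        have h1 := (π (Sum.inr s, h)).tsum_coe
        have h2 : ∀ b, b = a := fun b => Subsingleton.elim (α := PUnit) b a
        rwa [tsum_eq_single a fun b hb => absurd (h2 b) hb] at h1
      rw [ha, mul_one]
      by_cases hh : h.1 < H₁
      · have e2 : visitSet H₁ H₂ ⟨(Sum.inr s, h), a⟩ = (∅ : Set (ℕ → Step A)) :=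
          Set.eq_empty_of_forall_notMem fun x hx => hh.not_ge hx.1
        rw [e2, measure_empty, Finset.sum_eq_zero]
        intro o _
        refine if_neg fun h' => ?_
        cases o with
        | none => simp [embed_none] at h'
        | some s' => simp [embed_some_of_lt hh] at h'
      · have e2 : visitSet H₁ H₂ ⟨(Sum.inr s, h), a⟩ =
            ({x | x (H₁ - 1) ≠ none} : Set (ℕ → Step A)) :=
          Set.ext fun x => and_iff_right (not_lt.1 hh)
        rw [e2, SSP.trajLaw_ne_none, Fintype.sum_option, SSP.surv,
          ENNReal.ofReal_sum_of_nonneg fun _ _ => ENNReal.toReal_nonneg,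
          show min h.1 (H₁ - 1) = H₁ - 1 by omega]
        simp [embed_none, embed_some_of_le (not_lt.1 hh) h.2,
          ENNReal.ofReal_toReal (PMF.apply_ne_top _ _)]
  · intro i hi
    rw [hmap, Finset.sum_eq_zero, zero_mul]
    exact fun o _ => if_neg fun h' => hi (embed_layer h'.symm).symm

end Occupancy

end LoopFree

namespace SSP

/-! ### Costs-to-go and their truncations -/

section Cost

variable {S : Type u} [Fintype S] {A : S → Type v} [∀ s, Fintype (A s)]

theorem trajLaw_map (M : SSP S A) (ρ : ℕ → Policy A) (s : S) (n : ℕ) :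
    (M.trajLaw ρ s).map (fun x => x n) = (M.stepLaw ρ n (some s)).toMeasure := by
  refine Measure.ext_of_singleton fun y => ?_
  rw [Measure.map_apply (measurable_pi_apply n) (measurableSet_singleton y),
    PMF.toMeasure_apply_singleton _ _ (measurableSet_singleton y), ← trajLaw_eq]
  rfl

theorem lintegral_coord (M : SSP S A) (ρ : ℕ → Policy A) (s : S) (n : ℕ) (f : Step A → ℝ≥0∞) :
    ∫⁻ x, f (x n) ∂(M.trajLaw ρ s) = ∑ y, f y * M.stepLaw ρ n (some s) y := by
  rw [← lintegral_map (g := fun x : ℕ → Step A => x n) measurable_from_top (measurable_pi_apply n),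
    trajLaw_map, lintegral_fintype]
  simp only [PMF.toMeasure_apply_singleton _ _ (measurableSet_singleton _)]

theorem integral_coord (M : SSP S A) (ρ : ℕ → Policy A) (s : S) (n : ℕ) (f : Step A → ℝ) :
    ∫ x, f (x n) ∂(M.trajLaw ρ s) = ∑ y, (M.stepLaw ρ n (some s) y).toReal * f y := by
  have : IsProbabilityMeasure (M.stepLaw ρ n (some s)).toMeasure :=
    PMF.toMeasure.isProbabilityMeasure _
  rw [← integral_map (φ := fun x : ℕ → Step A => x n) (measurable_pi_apply n).aemeasurable
    measurable_from_top.aestronglyMeasurable,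
    trajLaw_map, integral_fintype Integrable.of_finite]
  simp only [measureReal_def, PMF.toMeasure_apply_singleton _ _ (measurableSet_singleton _),
    smul_eq_mul]

theorem lintegral_cost (M : SSP S A) (ρ : ℕ → Policy A) (s : S) (c : (Σ s, A s) → ℝ) :
    ∫⁻ x, ∑' i, ENNReal.ofReal (stepCost c (x i)) ∂(M.trajLaw ρ s) =
      ∑' i, ∑ y, ENNReal.ofReal (stepCost c y) * M.stepLaw ρ i (some s) y := by
  rw [lintegral_tsum]
  · exact tsum_congr fun i => M.lintegral_coord ρ s i fun y => ENNReal.ofReal (stepCost c y)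
  · exact fun i => ((measurable_from_top (f := fun y : Step A =>
      ENNReal.ofReal (stepCost c y))).comp (measurable_pi_apply i)).aemeasurable

theorem measurable_stepCost {S : Type u} {A : S → Type v} (y : Step A) : Measurable fun c : (Σ s, A s) → ℝ => stepCost c y := by
  cases y with
  | none => exact measurable_const
  | some p => exact measurable_pi_apply p

/-- The costs are random, so the cost-to-go must be measurable in `c`. Written through the
marginals, it is a countable sum of explicit functions of `c`. -/
theorem measurable_costToGo (M : SSP S A) (π : Policy A) (s : S) :
    Measurable fun c => M.costToGo π c s := by
  unfold costToGo
  simp only [lintegral_cost]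
  refine Measurable.ennreal_toReal (Measurable.tsum fun i => ?_)
  exact Finset.measurable_sum _ fun y _ => (measurable_stepCost y).ennreal_ofReal.mul_const _

theorem stepCost_nonneg {S : Type u} {A : S → Type v} {c : (Σ s, A s) → ℝ} (hc : ∀ p, 0 ≤ c p)
    (y : Step A) : 0 ≤ stepCost c y := by
  cases y with
  | none => exact le_rfl
  | some p => exact hc p

theorem stepCost_mono {S : Type u} {A : S → Type v} {c c' : (Σ s, A s) → ℝ} (hc : ∀ p, c p ≤ c' p)
    (y : Step A) : stepCost c y ≤ stepCost c' y := by
  cases y with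
  | none => exact le_rfl
  | some p => exact hc p

theorem numSteps_eq {S : Type u} {A : S → Type v} (x : ℕ → Step A) :
    numSteps x = ∑' i, ENNReal.ofReal (stepCost (fun _ => 1) (x i)) := by
  classical
  refine tsum_congr fun i => ?_
  cases x i <;> simp [stepCost]

theorem lintegral_cost_le_hitTime (M : SSP S A) (π : Policy A) {c : (Σ s, A s) → ℝ}
    (hc : ∀ p, c p ≤ 1) (s : S) :
    ∫⁻ x, ∑' i, ENNReal.ofReal (stepCost c (x i)) ∂(M.trajLaw (fun _ => π) s) ≤ M.hitTime π s := by
  refine lintegral_mono fun x => ?_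
  rw [numSteps_eq]
  exact ENNReal.tsum_le_tsum fun i => ENNReal.ofReal_le_ofReal (stepCost_mono hc _)

theorem hitTime_ne_top (M : SSP S A) {π : Policy A} (h : M.Proper π) (s : S) :
    M.hitTime π s ≠ ∞ := by
  rw [M.hitTime_eq h]
  exact ENNReal.ofReal_ne_top

theorem costToGo_le (M : SSP S A) {π : Policy A} (h : M.Proper π) {c : (Σ s, A s) → ℝ}
    (hc : ∀ p, c p ≤ 1) (s : S) : M.costToGo π c s ≤ (M.hitTime π s).toReal :=
  ENNReal.toReal_mono (M.hitTime_ne_top h s) (M.lintegral_cost_le_hitTime π hc s)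

theorem sum_le_costToGo (M : SSP S A) {π : Policy A} (h : M.Proper π) {c : (Σ s, A s) → ℝ}
    (hc0 : ∀ p, 0 ≤ c p) (hc : ∀ p, c p ≤ 1) (s : S) (n : ℕ) :
    ∑ i ∈ Finset.range n, ∫ x, stepCost c (x i) ∂(M.trajLaw (fun _ => π) s) ≤
      M.costToGo π c s := by
  -- Properness enters here: an infinite expected cost would be read as `0` by `toReal`.
  have hfin := (M.lintegral_cost_le_hitTime π hc s).trans_lt (M.hitTime_ne_top h s).lt_top
  rw [costToGo, ← ENNReal.ofReal_le_iff_le_toReal hfin.ne, lintegral_cost]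
  refine le_trans ?_ (ENNReal.sum_le_tsum (Finset.range n))
  simp only [integral_coord]
  rw [ENNReal.ofReal_sum_of_nonneg]
  · refine Finset.sum_le_sum fun i _ => ?_
    rw [ENNReal.ofReal_sum_of_nonneg]
    · refine Finset.sum_le_sum fun y _ => ?_
      rw [mul_comm, ENNReal.ofReal_mul (stepCost_nonneg hc0 y),
        ENNReal.ofReal_toReal (PMF.apply_ne_top _ _)]
    · exact fun y _ => mul_nonneg ENNReal.toReal_nonneg (stepCost_nonneg hc0 y)
  · exact fun i _ => Finset.sum_nonneg fun y _ =>
      mul_nonneg ENNReal.toReal_nonneg (stepCost_nonneg hc0 y)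

theorem integral_stepCost_one (M : SSP S A) (ρ : ℕ → Policy A) (s : S) (n : ℕ) :
    ∫ x, stepCost (fun _ => 1) (x n) ∂(M.trajLaw ρ s) = M.surv ρ n (some s) := by
  have h1 := sum_toReal_pmf (M.stepLaw ρ n (some s))
  rw [Fintype.sum_option, stepLaw_apply_none] at h1
  rw [integral_coord, Fintype.sum_option, surv_eq]
  simp only [stepCost, mul_one, mul_zero]
  linarith

theorem stepLaw_congr {S : Type u} {A : S → Type v} (M : SSP S A) {ρ ρ' : ℕ → Policy A} (n : ℕ)
    (h : ∀ i ≤ n, ρ i = ρ' i) (o : Option S) : M.stepLaw ρ n o = M.stepLaw ρ' n o := by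
  rw [stepLaw, stepLaw, M.stateLaw_congr n fun i hi => h i hi.le, h n le_rfl]

theorem integrable_coord (M : SSP S A) (ρ : ℕ → Policy A) (s : S) (n : ℕ) (f : Step A → ℝ) :
    Integrable (fun x => f (x n)) (M.trajLaw ρ s) :=
  Integrable.comp_measurable (f := fun x : ℕ → Step A => x n) (g := f) Integrable.of_finite
    (measurable_pi_apply n)

end Cost

end SSP

namespace LoopFree

/-! ### Comparing the loop-free instance with the MDP -/

section Comparison

variable {S : Type u} [Fintype S] {A : S → Type v} [∀ s, Fintype (A s)]

/-- Occupancies are probabilities of visit sets, so this is linearity of the integral. The choice of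
`πf` is immaterial, since visit sets involve only the first `H₁` steps. -/
theorem pairing_occ (M : SSP S A) (H₁ H₂ : ℕ) (h₁ : 0 < H₁) (πf : ∀ s, A s)
    (π : Policy (Action A (H₁ + H₂))) (g : Triple A (H₁ + H₂) → ℝ) :
    pairing (occ M H₁ H₂ h₁ π) g =
      ∫ x, pairing (visits H₁ H₂ x) g ∂(M.trajLaw (sigma H₁ H₂ πf π) M.init) := by
  unfold pairing
  simp only [visits_eq_indicator, occ_eq M H₁ H₂ h₁ πf]
  rw [integral_finsetSum]
  · refine Finset.sum_congr rfl fun p _ => ?_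
    rw [integral_mul_const, integral_indicator_one (measurableSet_visitSet H₁ H₂ p)]
  · exact fun p _ => (Integrable.indicator (integrable_const (1 : ℝ))
      (measurableSet_visitSet H₁ H₂ p)).mul_const _

theorem pairing_occ_cost (M : SSP S A) (H₁ H₂ : ℕ) (h₁ : 0 < H₁) (πf : ∀ s, A s)
    (π : Policy (Action A (H₁ + H₂))) (c : (Σ s, A s) → ℝ) :
    pairing (occ M H₁ H₂ h₁ π) (cost c) =
      ∑ i ∈ Finset.range H₁, ∫ x, SSP.stepCost c (x i) ∂(M.trajLaw (sigma H₁ H₂ πf π) M.init) +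
        H₂ * M.surv (sigma H₁ H₂ πf π) (H₁ - 1) (some M.init) := by
  rw [pairing_occ M H₁ H₂ h₁ πf]
  simp only [pairing_visits_cost]
  rw [integral_add, integral_finsetSum, integral_const_mul, SSP.integral_stepCost_one]
  · exact fun i _ => M.integrable_coord _ _ i _
  · exact integrable_finsetSum _ fun i _ => M.integrable_coord _ _ i _
  · exact (M.integrable_coord _ _ (H₁ - 1) _).const_mul _

theorem sigma_mimic {S : Type u} {A : S → Type v} (H₁ H₂ : ℕ) (πf π : ∀ s, A s) {i : ℕ} (hi : i < H₁) :
    sigma H₁ H₂ πf (detPolicy (mimic π)) i = detPolicy π :=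
  funext fun _ => dif_pos hi

/-- The first `H₁` steps have the same law in both models and their costs are part of the
nonnegative total; only the `H₂` fast layers are extra. -/
theorem pairing_occStar_le (M : SSP S A) (H₁ H₂ : ℕ) (h₁ : 0 < H₁) {π : ∀ s, A s}
    (hπ : M.Proper (detPolicy π)) {c : (Σ s, A s) → ℝ} (hc0 : ∀ p, 0 ≤ c p) (hc : ∀ p, c p ≤ 1) :
    pairing (occStar M H₁ H₂ h₁ π) (cost c) ≤ M.costToGo (detPolicy π) c M.init +
      H₂ * M.surv (fun _ => detPolicy π) (H₁ - 1) (some M.init) := by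
  -- `π` itself serves as the policy played after step `H₁`, which does not affect the quantities
  -- involved.
  rw [occStar, pairing_occ_cost M H₁ H₂ h₁ π,
    M.surv_congr (H₁ - 1) fun i hi => sigma_mimic H₁ H₂ π π (show i < H₁ by omega)]
  gcongr
  refine le_trans (Finset.sum_le_sum fun i hi => ?_) (M.sum_le_costToGo hπ hc0 hc M.init H₁)
  rw [Finset.mem_range] at hi
  rw [SSP.integral_coord, SSP.integral_coord,
    M.stepLaw_congr i fun j hj => sigma_mimic H₁ H₂ π π (show j < H₁ by omega)]

/-- From index `H₁` on, `sigma` is the stationary fast policy, so its survival is a subprobability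
mixture of survivals of that policy; this transfers the decay estimates to it. -/
theorem surv_sigma_add {S : Type u} [Fintype S] {A : S → Type v} (M : SSP S A) (H₁ H₂ : ℕ) (πf : ∀ s, A s)
    (π : Policy (Action A (H₁ + H₂))) (n : ℕ) (o : Option S) :
    M.surv (sigma H₁ H₂ πf π) (H₁ + n) o =
      ∑ s, (M.stateLaw (sigma H₁ H₂ πf π) H₁ o (some s)).toReal *
        M.surv (fun _ => detPolicy πf) n (some s) := by
  rw [SSP.surv_add]
  refine Finset.sum_congr rfl fun s _ => ?_
  rw [M.surv_congr n fun i _ => show sigma H₁ H₂ πf π (H₁ + i) = detPolicy πf from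
    funext fun s => dif_neg (by omega)]

variable (M : SSP S A) (H₁ H₂ : ℕ) {πf : ∀ s, A s} (hf : M.IsFast πf)
  (π : Policy (Action A (H₁ + H₂)))

include hf in
theorem one_le_diameter : 1 ≤ M.diameter := by
  rw [M.diameter_eq hf]
  exact M.one_le_maxHitTime hf.1

include hf in
theorem surv_sigma_le (n : ℕ) (o : Option S) :
    M.surv (sigma H₁ H₂ πf π) (H₁ + n) o ≤ Real.exp (1 - n / M.diameter) := by
  rw [surv_sigma_add]
  have h1 : ∀ s, M.surv (fun _ => detPolicy πf) n (some s) ≤ Real.exp (1 - n / M.diameter) := by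
    intro s
    rw [M.diameter_eq hf]
    exact M.surv_le_exp _ (M.summable_of_proper hf.1) (M.tsum_surv_le_maxHitTime hf.1)
      (M.one_le_maxHitTime hf.1) n _
  refine (Finset.sum_le_sum fun s _ =>
    mul_le_mul_of_nonneg_left (h1 s) ENNReal.toReal_nonneg).trans ?_
  rw [← Finset.sum_mul]
  exact mul_le_of_le_one_left (Real.exp_pos _).le (M.surv_le_one _ H₁ o)

include hf in
theorem summable_surv_sigma (n : ℕ) (o : Option S) :
    Summable fun j => M.surv (sigma H₁ H₂ πf π) (H₁ + n + j) o := by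
  simp only [add_assoc, surv_sigma_add]
  exact summable_sum fun s _ =>
    (M.summable_surv _ (M.summable_of_proper hf.1) n (some s)).mul_left _

include hf in
theorem tsum_surv_sigma_le (n : ℕ) (o : Option S) :
    ∑' j, M.surv (sigma H₁ H₂ πf π) (H₁ + n + j) o ≤
      M.diameter * Real.exp (-n / M.diameter) := by
  simp only [add_assoc, surv_sigma_add]
  rw [Summable.tsum_finsetSum fun s _ =>
    (M.summable_surv _ (M.summable_of_proper hf.1) n (some s)).mul_left _]
  simp only [tsum_mul_left]
  have h1 : ∀ s, ∑' j, M.surv (fun _ => detPolicy πf) (n + j) (some s) ≤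
      M.diameter * Real.exp (-n / M.diameter) := by
    intro s
    rw [M.diameter_eq hf]
    exact M.tsum_surv_le _ (M.summable_of_proper hf.1) (M.tsum_surv_le_maxHitTime hf.1)
      (M.one_le_maxHitTime hf.1) n _
  refine (Finset.sum_le_sum fun s _ =>
    mul_le_mul_of_nonneg_left (h1 s) ENNReal.toReal_nonneg).trans ?_
  rw [← Finset.sum_mul]
  exact mul_le_of_le_one_left
    (mul_nonneg (zero_le_one.trans (one_le_diameter M hf)) (Real.exp_pos _).le)
    (M.surv_le_one _ H₁ o)

end Comparison

end LoopFree

/-! ### An exponential supermartingale inequality -/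

theorem aestronglyMeasurable_finsetSum {Ω ι : Type*} {m mΩ : MeasurableSpace Ω} {μ : Measure[mΩ] Ω}
    (s : Finset ι) {f : ι → Ω → ℝ} (hf : ∀ i ∈ s, AEStronglyMeasurable[m] (f i) μ) :
    AEStronglyMeasurable[m] (fun ω => ∑ i ∈ s, f i ω) μ := by
  classical
  induction s using Finset.induction_on with
  | empty => simpa using aestronglyMeasurable_const
  | insert i s hi ih =>
    simp only [Finset.sum_insert hi]
    exact (hf i (Finset.mem_insert_self i s)).add
      (ih fun j hj => hf j (Finset.mem_insert_of_mem hj))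

section Supermartingale

variable {Ω : Type w} {mΩ : MeasurableSpace Ω} {μ : Measure Ω} [IsProbabilityMeasure μ]

/-- A process whose conditional exponential moments are at most `1 + a n` gives rise to an
exponential supermartingale. -/
theorem integral_exp_sum_le_one (𝓕 : Filtration ℕ mΩ) {f a : ℕ → Ω → ℝ}
    (hf : ∀ n, AEStronglyMeasurable[𝓕 (n + 1)] (f n) μ)
    (ha : ∀ n, AEStronglyMeasurable[𝓕 n] (a n) μ)
    (hf1 : ∀ n ω, f n ω ≤ 1) (ha0 : ∀ n ω, 0 ≤ a n ω)
    (hstep : ∀ n (W : Ω → ℝ), AEStronglyMeasurable[𝓕 n] W μ → (∀ ω, 0 ≤ W ω) →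
      (∃ b, ∀ ω, W ω ≤ b) → ∫ ω, W ω * Real.exp (f n ω) ∂μ ≤ ∫ ω, W ω * (1 + a n ω) ∂μ) (n : ℕ) :
    Integrable (fun ω => Real.exp (∑ i ∈ Finset.range n, (f i ω - a i ω))) μ ∧
      ∫ ω, Real.exp (∑ i ∈ Finset.range n, (f i ω - a i ω)) ∂μ ≤ 1 := by
  have hmeas : ∀ n, AEStronglyMeasurable[𝓕 n]
      (fun ω => Real.exp (∑ i ∈ Finset.range n, (f i ω - a i ω))) μ := by
    intro n
    refine Real.continuous_exp.comp_aestronglyMeasurable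
      (aestronglyMeasurable_finsetSum _ fun i hi => ?_)
    rw [Finset.mem_range] at hi
    exact ((hf i).mono (𝓕.mono hi)).sub ((ha i).mono (𝓕.mono hi.le))
  -- The one-sided bounds `f ≤ 1` and `0 ≤ a` already bound the exponentials, which provides all
  -- integrability needed.
  have hbound : ∀ n ω, Real.exp (∑ i ∈ Finset.range n, (f i ω - a i ω)) ≤ Real.exp n := by
    intro n ω
    refine Real.exp_le_exp.2 ?_
    refine (Finset.sum_le_card_nsmul _ _ 1 fun i _ => ?_).trans (by simp)
    linarith [hf1 i ω, ha0 i ω]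
  have hint : ∀ n, Integrable (fun ω => Real.exp (∑ i ∈ Finset.range n, (f i ω - a i ω))) μ :=
    fun n => Integrable.of_bound ((hmeas n).mono (𝓕.le n)) (Real.exp n)
      (Filter.Eventually.of_forall fun ω => by
        rw [Real.norm_eq_abs, abs_of_pos (Real.exp_pos _)]
        exact hbound n ω)
  refine ⟨hint n, ?_⟩
  induction n with
  | zero => simp
  | succ n ih =>
    -- `hstep` is the bound of the conditional expectation of `exp (f n)` by `1 + a n`, tested
    -- against bounded nonnegative weights. The weight chosen here also contains `exp (-a n)`, and
    -- `(1 + a n) * exp (-a n) ≤ 1` closes the induction.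
    let W : Ω → ℝ := fun ω =>
      Real.exp (∑ i ∈ Finset.range n, (f i ω - a i ω)) * Real.exp (-a n ω)
    have h1 : ∀ ω, Real.exp (∑ i ∈ Finset.range (n + 1), (f i ω - a i ω)) =
        W ω * Real.exp (f n ω) := by
      intro ω
      simp only [W]
      rw [← Real.exp_add, ← Real.exp_add, Finset.sum_range_succ]
      ring_nf
    simp only [h1]
    refine (hstep n W ?_ ?_ ⟨Real.exp n, fun ω => ?_⟩).trans (le_trans ?_ ih)
    · exact (hmeas n).mul (Real.continuous_exp.comp_aestronglyMeasurable (ha n).neg)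
    · exact fun ω => (mul_pos (Real.exp_pos _) (Real.exp_pos _)).le
    · refine (mul_le_of_le_one_right (Real.exp_pos _).le ?_).trans (hbound n ω)
      exact Real.exp_le_one_iff.2 (neg_nonpos.2 (ha0 n ω))
    · refine integral_mono_of_nonneg (Filter.Eventually.of_forall fun ω => ?_) (hint n)
        (Filter.Eventually.of_forall fun ω => ?_)
      · exact mul_nonneg (mul_pos (Real.exp_pos _) (Real.exp_pos _)).le
          (by linarith [ha0 n ω])
      · simp only [W]
        rw [mul_assoc]
        refine mul_le_of_le_one_right (Real.exp_pos _).le ?_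
        rw [Real.exp_neg, inv_mul_le_one₀ (Real.exp_pos _), add_comm]
        exact Real.add_one_le_exp _

/-- The deviation inequality for the process of `integral_exp_sum_le_one`. -/
theorem measure_sum_gt_le (𝓕 : Filtration ℕ mΩ) {f a : ℕ → Ω → ℝ}
    (hf : ∀ n, AEStronglyMeasurable[𝓕 (n + 1)] (f n) μ)
    (ha : ∀ n, AEStronglyMeasurable[𝓕 n] (a n) μ)
    (hf1 : ∀ n ω, f n ω ≤ 1) (ha0 : ∀ n ω, 0 ≤ a n ω)
    (hstep : ∀ n (W : Ω → ℝ), AEStronglyMeasurable[𝓕 n] W μ → (∀ ω, 0 ≤ W ω) →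
      (∃ b, ∀ ω, W ω ≤ b) → ∫ ω, W ω * Real.exp (f n ω) ∂μ ≤ ∫ ω, W ω * (1 + a n ω) ∂μ) (n : ℕ)
    {ε : ℝ} (hε : 0 < ε) :
    μ {ω | Real.log (1 / ε) < ∑ i ∈ Finset.range n, (f i ω - a i ω)} ≤ ENNReal.ofReal ε := by
  obtain ⟨hint, hle⟩ := integral_exp_sum_le_one 𝓕 hf ha hf1 ha0 hstep n
  have h1 := (mul_meas_ge_le_integral_of_nonneg (Filter.Eventually.of_forall fun ω =>
    (Real.exp_pos (∑ i ∈ Finset.range n, (f i ω - a i ω))).le) hint (1 / ε)).trans hle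
  rw [one_div_mul_eq_div, div_le_one hε] at h1
  refine le_trans (measure_mono ?_)
    ((ENNReal.le_ofReal_iff_toReal_le (measure_ne_top _ _) hε.le).2 h1)
  intro ω hω
  rw [Set.mem_ofPred_eq] at hω ⊢
  exact ((Real.log_lt_iff_lt_exp (by positivity)).1 hω).le

end Supermartingale

/-! ### Conditional laws in the learning protocol -/

namespace LoopFree

theorem pairing_const_mul {S : Type u} [Fintype S] {A : S → Type v} [∀ s, Fintype (A s)] {H : ℕ}
    (f g : Triple A H → ℝ) (r : ℝ) : pairing f (fun p => r * g p) = r * pairing f g := by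
  rw [pairing, pairing, Finset.mul_sum]
  exact Finset.sum_congr rfl fun p _ => by ring

theorem pairing_add {S : Type u} [Fintype S] {A : S → Type v} [∀ s, Fintype (A s)] {H : ℕ}
    (f g g' : Triple A H → ℝ) :
    pairing f (fun p => g p + g' p) = pairing f g + pairing f g' := by
  simp only [pairing, mul_add, Finset.sum_add_distrib]

theorem pairing_sub_left {S : Type u} [Fintype S] {A : S → Type v} [∀ s, Fintype (A s)] {H : ℕ}
    (f f' g : Triple A H → ℝ) :
    pairing (f - f') g = pairing f g - pairing f' g := by
  simp only [pairing, Pi.sub_apply, sub_mul, Finset.sum_sub_distrib]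

theorem pairing_nonneg {S : Type u} [Fintype S] {A : S → Type v} [∀ s, Fintype (A s)] {H : ℕ}
    {f g : Triple A H → ℝ} (hf : ∀ p, 0 ≤ f p) (hg : ∀ p, 0 ≤ g p) : 0 ≤ pairing f g :=
  Finset.sum_nonneg fun p _ => mul_nonneg (hf p) (hg p)

theorem occ_nonneg {S : Type u} [Fintype S] {A : S → Type v} [∀ s, Fintype (A s)] (M : SSP S A)
    (H₁ H₂ : ℕ) (h₁ : 0 < H₁) (π : Policy (Action A (H₁ + H₂))) (p : Triple A (H₁ + H₂)) :
    0 ≤ occ M H₁ H₂ h₁ π p :=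
  ENNReal.toReal_nonneg

theorem layerMul_nonneg {S : Type u} {A : S → Type v} {H : ℕ} {g : Triple A H → ℝ}
    (hg : ∀ p, 0 ≤ g p) (p : Triple A H) : 0 ≤ layerMul g p :=
  mul_nonneg (by positivity) (hg p)

theorem layerMul_le {S : Type u} {A : S → Type v} {H : ℕ} {g : Triple A H → ℝ}
    (hg0 : ∀ p, 0 ≤ g p) (hg : ∀ p, g p ≤ 1) (p : Triple A H) : layerMul g p ≤ H := by
  have h1 : ((p.1.2 : ℕ) : ℝ) + 1 ≤ H := by exact_mod_cast p.1.2.2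
  calc layerMul g p ≤ H * 1 := mul_le_mul h1 (hg p) (hg0 p) (by positivity)
    _ = H := mul_one _

section Play

variable {S : Type u} [Fintype S] {A : S → Type v} [∀ s, Fintype (A s)] {M : SSP S A}
  {πf : ∀ s, A s} {H₁ H₂ : ℕ} {Ω : Type w} {mΩ : MeasurableSpace Ω} {μ : Measure Ω}
  [IsProbabilityMeasure μ] {𝓕 : Filtration ℕ mΩ} {K : ℕ} {c : Fin K → Ω → (Σ s, A s) → ℝ}
  {π : Fin K → Ω → Policy (Action A (H₁ + H₂))} {X : Fin K → Ω → ℕ → Step A}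

namespace IsPlay

section

variable (hP : IsPlay M πf H₁ H₂ μ 𝓕 c π X)

include hP

omit [IsProbabilityMeasure μ] in
theorem measurable_traj_succ (k : Fin K) : Measurable[𝓕 ((k : ℕ) + 1)] (X k) :=
  @measurable_pi_lambda _ _ _ (𝓕 ((k : ℕ) + 1)) _ _ fun i => hP.traj_adapted k i

omit [IsProbabilityMeasure μ] in
theorem measurable_traj (k : Fin K) : Measurable (X k) :=
  (hP.measurable_traj_succ k).mono (𝓕.le _) le_rfl

-- The trajectory law agrees almost everywhere with a conditional expectation given `𝓕 k`.
-- Measurability is therefore obtained only up to null sets, which is why the supermartingale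
-- argument uses `AEStronglyMeasurable`.
omit [IsProbabilityMeasure μ] in
theorem aestronglyMeasurable_law (k : Fin K) {B : Set (ℕ → Step A)} (hB : MeasurableSet B) :
    AEStronglyMeasurable[𝓕 (k : ℕ)]
      (fun ω => (M.trajLaw (sigma H₁ H₂ πf (π k ω)) M.init).real B) μ :=
  ⟨_, stronglyMeasurable_condExp, (hP.traj_law k B hB).symm⟩

/-- The pull-out property in integrated form: against weights known at the start of the episode,
events of the trajectory may be replaced by their conditional probabilities. -/
theorem integral_mul_indicator (k : Fin K) {B : Set (ℕ → Step A)} (hB : MeasurableSet B)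
    {g : Ω → ℝ} (hg : AEStronglyMeasurable[𝓕 (k : ℕ)] g μ) {b : ℝ} (hb : ∀ ω, |g ω| ≤ b) :
    ∫ ω, g ω * B.indicator 1 (X k ω) ∂μ =
      ∫ ω, g ω * (M.trajLaw (sigma H₁ H₂ πf (π k ω)) M.init).real B ∂μ := by
  have hm := 𝓕.le (k : ℕ)
  have hXB : MeasurableSet (X k ⁻¹' B) := hP.measurable_traj k hB
  have hi : Integrable ((X k ⁻¹' B).indicator fun _ => (1 : ℝ)) μ :=
    (integrable_const _).indicator hXB
  have h := condExp_stronglyMeasurable_mul_of_bound₀ hm hg hi b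
    (Filter.Eventually.of_forall hb)
  rw [← integral_condExp hm]
  refine integral_congr_ae ?_
  filter_upwards [h, hP.traj_law k B hB] with ω h1 h2
  rw [← h2]
  exact h1

theorem measureReal_preimage (k : Fin K) {B : Set (ℕ → Step A)} (hB : MeasurableSet B) :
    μ.real (X k ⁻¹' B) = ∫ ω, (M.trajLaw (sigma H₁ H₂ πf (π k ω)) M.init).real B ∂μ := by
  have h := hP.integral_mul_indicator k hB (g := fun _ => 1) aestronglyMeasurable_const (b := 1)
    (by simp)
  simp only [one_mul] at h
  rw [← h, ← integral_indicator_one (hP.measurable_traj k hB)]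
  rfl

theorem absorbing (k : Fin K) : ∀ᵐ ω ∂μ, ∀ n, X k ω n = none → X k ω (n + 1) = none := by
  rw [ae_all_iff]
  intro n
  have hB : MeasurableSet {x : ℕ → Step A | ¬ (x n = none → x (n + 1) = none)} := by
    have h1 := SSP.measurableSet_coord (A := A) n {none}
    have h2 := SSP.measurableSet_coord (A := A) (n + 1) {none}
    have : {x : ℕ → Step A | ¬ (x n = none → x (n + 1) = none)} =
        {x | x n ∈ ({none} : Set (Step A))} \ {x | x (n + 1) ∈ ({none} : Set (Step A))} := by
      ext x
      simp
    rw [this]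
    exact h1.diff h2
  have h := hP.measureReal_preimage k hB
  have h0 : ∀ ω, (M.trajLaw (sigma H₁ H₂ πf (π k ω)) M.init).real
      {x : ℕ → Step A | ¬ (x n = none → x (n + 1) = none)} = 0 := by
    intro ω
    rw [measureReal_def, ae_iff.1 (ae_all_iff.1 (M.trajLaw_absorbing _ M.init) n),
      ENNReal.toReal_zero]
  simp only [h0, integral_zero] at h
  rw [measureReal_eq_zero_iff] at h
  exact h

theorem measureReal_ne_none (k : Fin K) (n : ℕ) :
    μ.real {ω | X k ω n ≠ none} =
      ∫ ω, M.surv (sigma H₁ H₂ πf (π k ω)) n (some M.init) ∂μ := by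
  have h := hP.measureReal_preimage k
    (B := {x | x n ≠ none}) (SSP.measurableSet_coord n {y | y ≠ none})
  simp only [measureReal_def (M.trajLaw _ _), SSP.trajLaw_ne_none,
    ENNReal.toReal_ofReal (M.surv_nonneg _ _ _)] at h
  exact h

theorem integrable_surv (k : Fin K) (n : ℕ) :
    Integrable (fun ω => M.surv (sigma H₁ H₂ πf (π k ω)) n (some M.init)) μ := by
  have h := hP.aestronglyMeasurable_law k
    (B := {x | x n ≠ none}) (SSP.measurableSet_coord n {y | y ≠ none})
  simp only [measureReal_def, SSP.trajLaw_ne_none,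
    ENNReal.toReal_ofReal (M.surv_nonneg _ _ _)] at h
  refine Integrable.of_bound (h.mono (𝓕.le _)) 1 (Filter.Eventually.of_forall fun ω => ?_)
  rw [Real.norm_eq_abs, abs_of_nonneg (M.surv_nonneg _ _ _)]
  exact M.surv_le_one _ _ _

omit [IsProbabilityMeasure μ] in
theorem aestronglyMeasurable_occ (h₁ : 0 < H₁) (k : Fin K) (p : Triple A (H₁ + H₂)) :
    AEStronglyMeasurable[𝓕 (k : ℕ)] (fun ω => occ M H₁ H₂ h₁ (π k ω) p) μ := by
  simp only [occ_eq M H₁ H₂ h₁ πf]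
  exact hP.aestronglyMeasurable_law k (measurableSet_visitSet H₁ H₂ p)

omit [IsProbabilityMeasure μ] in
theorem aestronglyMeasurable_pairing_occ (h₁ : 0 < H₁) (k : Fin K)
    {g : Ω → Triple A (H₁ + H₂) → ℝ}
    (hg : ∀ p, AEStronglyMeasurable[𝓕 (k : ℕ)] (fun ω => g ω p) μ) :
    AEStronglyMeasurable[𝓕 (k : ℕ)] (fun ω => pairing (occ M H₁ H₂ h₁ (π k ω)) (g ω)) μ :=
  aestronglyMeasurable_finsetSum _ fun p _ => (hP.aestronglyMeasurable_occ h₁ k p).mul (hg p)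

omit [IsProbabilityMeasure μ] in
theorem measurable_visits (k : Fin K) (p : Triple A (H₁ + H₂)) :
    Measurable[𝓕 ((k : ℕ) + 1)] (fun ω => visits H₁ H₂ (X k ω) p) := by
  simp only [visits_eq_indicator]
  exact (measurable_one.indicator (measurableSet_visitSet H₁ H₂ p)).comp
    (hP.measurable_traj_succ k)

omit [IsProbabilityMeasure μ] in
theorem aestronglyMeasurable_pairing_visits (k : Fin K) {g : Ω → Triple A (H₁ + H₂) → ℝ}
    (hg : ∀ p, AEStronglyMeasurable[𝓕 (k : ℕ)] (fun ω => g ω p) μ) :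
    AEStronglyMeasurable[𝓕 ((k : ℕ) + 1)] (fun ω => pairing (visits H₁ H₂ (X k ω)) (g ω)) μ :=
  aestronglyMeasurable_finsetSum _ fun p _ =>
    (hP.measurable_visits k p).stronglyMeasurable.aestronglyMeasurable.mul
      ((hg p).mono (𝓕.mono (Nat.le_succ _)))

omit hP in
theorem visits_mem {S : Type u} {A : S → Type v} {H₁ H₂ : ℕ} (x : ℕ → Step A) (p : Triple A (H₁ + H₂)) :
    0 ≤ visits H₁ H₂ x p ∧ visits H₁ H₂ x p ≤ 1 := by
  rw [visits_eq_indicator]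
  exact ⟨Set.indicator_nonneg (fun _ _ => zero_le_one) x,
    Set.indicator_le_self' (fun _ _ => zero_le_one) x⟩

omit hP in
theorem occ_le_one (M : SSP S A) (h₁ : 0 < H₁) (π : Policy (Action A (H₁ + H₂)))
    (p : Triple A (H₁ + H₂)) : occ M H₁ H₂ h₁ π p ≤ 1 := by
  -- Writing the occupancy as a probability needs some policy to follow after `H₁`; one is picked
  -- from the supports of `π` in the first layer.
  rw [occ_eq M H₁ H₂ h₁ (fun s => ((π (Sum.inl s, ⟨0, by omega⟩)).support_nonempty.some : A s))]
  exact measureReal_le_one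

omit [IsProbabilityMeasure μ] hP in
theorem integrable_mul_of_le_one [IsFiniteMeasure μ] {f g : Ω → ℝ} (hf : AEStronglyMeasurable f μ)
    (hg : AEStronglyMeasurable g μ) (hf1 : ∀ ω, 0 ≤ f ω ∧ f ω ≤ 1) {b : ℝ}
    (hb : ∀ ω, |g ω| ≤ b) : Integrable (fun ω => f ω * g ω) μ := by
  refine Integrable.of_bound (hf.mul hg) b (Filter.Eventually.of_forall fun ω => ?_)
  rw [norm_mul, Real.norm_eq_abs, Real.norm_eq_abs, abs_of_nonneg (hf1 ω).1]
  exact (mul_le_of_le_one_left (abs_nonneg _) (hf1 ω).2).trans (hb ω)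

theorem integrable_pairing_occ (h₁ : 0 < H₁) (k : Fin K) {g : Ω → Triple A (H₁ + H₂) → ℝ}
    (hg : ∀ p, AEStronglyMeasurable[𝓕 (k : ℕ)] (fun ω => g ω p) μ) {b : ℝ}
    (hb : ∀ ω p, |g ω p| ≤ b) :
    Integrable (fun ω => pairing (occ M H₁ H₂ h₁ (π k ω)) (g ω)) μ :=
  integrable_finsetSum _ fun p _ => integrable_mul_of_le_one
    ((hP.aestronglyMeasurable_occ h₁ k p).mono (𝓕.le _)) ((hg p).mono (𝓕.le _))
    (fun _ => ⟨occ_nonneg _ _ _ _ _ _, occ_le_one M h₁ _ p⟩) fun ω => hb ω p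

theorem integrable_pairing_visits (k : Fin K) {g : Ω → Triple A (H₁ + H₂) → ℝ}
    (hg : ∀ p, AEStronglyMeasurable[𝓕 (k : ℕ)] (fun ω => g ω p) μ) {b : ℝ}
    (hb : ∀ ω p, |g ω p| ≤ b) :
    Integrable (fun ω => pairing (visits H₁ H₂ (X k ω)) (g ω)) μ :=
  integrable_finsetSum _ fun p _ => integrable_mul_of_le_one
    ((hP.measurable_visits k p).stronglyMeasurable.aestronglyMeasurable.mono (𝓕.le _))
    ((hg p).mono (𝓕.le _)) (fun _ => visits_mem _ p) fun ω => hb ω p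

/-- The conditional expectation of the visit counts is the occupancy measure. -/
theorem integral_pairing_visits (h₁ : 0 < H₁) (k : Fin K) {g : Ω → Triple A (H₁ + H₂) → ℝ}
    (hg : ∀ p, AEStronglyMeasurable[𝓕 (k : ℕ)] (fun ω => g ω p) μ) {b : ℝ}
    (hb : ∀ ω p, |g ω p| ≤ b) :
    ∫ ω, pairing (visits H₁ H₂ (X k ω)) (g ω) ∂μ =
      ∫ ω, pairing (occ M H₁ H₂ h₁ (π k ω)) (g ω) ∂μ := by
  unfold pairing
  rw [integral_finsetSum, integral_finsetSum]
  · refine Finset.sum_congr rfl fun p _ => ?_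
    simp only [mul_comm _ (g _ p), visits_eq_indicator, occ_eq M H₁ H₂ h₁ πf]
    exact hP.integral_mul_indicator k (measurableSet_visitSet H₁ H₂ p) (hg p) fun ω => hb ω p
  · exact fun p _ => integrable_mul_of_le_one
      ((hP.aestronglyMeasurable_occ h₁ k p).mono (𝓕.le _)) ((hg p).mono (𝓕.le _))
      (fun _ => ⟨occ_nonneg _ _ _ _ _ _, occ_le_one M h₁ _ p⟩) fun ω => hb ω p
  · exact fun p _ => integrable_mul_of_le_one
      ((hP.measurable_visits k p).stronglyMeasurable.aestronglyMeasurable.mono (𝓕.le _))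
      ((hg p).mono (𝓕.le _)) (fun _ => visits_mem _ p) fun ω => hb ω p

omit [IsProbabilityMeasure μ] in
theorem measurable_cost (k : Fin K) (p : Triple A (H₁ + H₂)) :
    Measurable[𝓕 (k : ℕ)] fun ω => cost (c k ω) p := by
  obtain ⟨⟨s | s, h⟩, a⟩ := p
  · exact hP.cost_adapted k ⟨s, a⟩
  · exact measurable_const

omit [IsProbabilityMeasure μ] in
theorem loopFree_cost_mem (k : Fin K) (ω : Ω) (p : Triple A (H₁ + H₂)) :
    0 ≤ cost (c k ω) p ∧ cost (c k ω) p ≤ 1 :=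
  ⟨cost_nonneg (fun p => (hP.cost_mem k ω p).1) p, cost_le_one (fun p => (hP.cost_mem k ω p).2) p⟩

end

end IsPlay

end Play

end LoopFree

namespace SSP

/-! ### Splitting the cost of an episode at time `H₁ + H₂` -/

section TailSteps

variable {S : Type u} {A : S → Type v}

/-- The number of steps from time `N` on. -/
noncomputable def tailSteps (N : ℕ) (x : ℕ → Step A) : ℝ≥0∞ :=
  ∑' j, ENNReal.ofReal (stepCost (fun _ => 1) (x (N + j)))

theorem eq_none_of_le {x : ℕ → Step A} (hx : ∀ n, x n = none → x (n + 1) = none) {m n : ℕ}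
    (hmn : m ≤ n) (hm : x m = none) : x n = none :=
  Nat.le_induction hm (fun k _ hk => hx k hk) n hmn

theorem tailSteps_eq_zero {x : ℕ → Step A} (hx : ∀ n, x n = none → x (n + 1) = none) {N : ℕ}
    (hN : x N = none) : tailSteps N x = 0 := by
  refine ENNReal.tsum_eq_zero.2 fun j => ?_
  rw [eq_none_of_le hx (Nat.le_add_right N j) hN]
  simp [stepCost]

theorem stepCost_le_of_le {x : ℕ → Step A} (hx : ∀ n, x n = none → x (n + 1) = none)
    {c : (Σ s, A s) → ℝ} (hc : ∀ p, c p ≤ 1) {m n : ℕ} (hmn : m ≤ n) :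
    stepCost c (x n) ≤ stepCost (fun _ => 1) (x m) := by
  cases hm : x m with
  | none => rw [eq_none_of_le hx hmn hm]; rfl
  | some p =>
    cases x n with
    | none => exact zero_le_one
    | some q => exact hc q

/-- The total cost of an episode is at most the cost of the first `H₁` steps, plus `H₂` unless the
goal is reached before, plus the number of steps after time `H₁ + H₂`. -/
theorem tsum_stepCost_le {x : ℕ → Step A} (hx : ∀ n, x n = none → x (n + 1) = none)
    {c : (Σ s, A s) → ℝ} (hc0 : ∀ p, 0 ≤ c p) (hc : ∀ p, c p ≤ 1) (H₁ H₂ : ℕ)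
    (hfin : tailSteps (H₁ + H₂) x ≠ ∞) :
    ∑' i, stepCost c (x i) ≤ ∑ i ∈ Finset.range H₁, stepCost c (x i) +
      H₂ * stepCost (fun _ => 1) (x (H₁ - 1)) + (tailSteps (H₁ + H₂) x).toReal := by
  have h1 : ∀ y : Step A, 0 ≤ stepCost (fun _ => 1) y := stepCost_nonneg fun _ => zero_le_one
  have hs1 : Summable fun j => stepCost (fun _ => 1) (x (H₁ + H₂ + j)) := by
    have := ENNReal.summable_toReal hfin
    simpa only [ENNReal.toReal_ofReal (h1 _)] using this
  have hs2 : Summable fun j => stepCost c (x (H₁ + H₂ + j)) :=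
    Summable.of_nonneg_of_le (fun j => stepCost_nonneg hc0 _) (fun j => stepCost_mono hc _) hs1
  have hs3 : Summable fun j => stepCost c (x j) := by
    refine (summable_nat_add_iff (H₁ + H₂)).1 ?_
    simpa only [add_comm] using hs2
  have h2 := hs3.sum_add_tsum_nat_add (H₁ + H₂)
  simp only [add_comm _ (H₁ + H₂)] at h2
  rw [← h2, Finset.sum_range_add]
  refine add_le_add (add_le_add le_rfl ?_) ?_
  -- By absorption, a step with index at least `H₁` can cost anything only if the goal is not yet
  -- reached at index `H₁ - 1`.
  · refine (Finset.sum_le_card_nsmul _ _ (stepCost (fun _ => 1) (x (H₁ - 1))) fun i _ => ?_).trans ?_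
    · exact stepCost_le_of_le hx hc (by omega)
    · simp
  · rw [tailSteps, ENNReal.tsum_toReal_eq fun _ => ENNReal.ofReal_ne_top]
    simp only [ENNReal.toReal_ofReal (h1 _)]
    exact hs2.tsum_le_tsum (fun j => stepCost_mono hc _) hs1

end TailSteps

end SSP

namespace LoopFree

/-! ### Deviation and tail bounds for the play -/

section Play

variable {S : Type u} [Fintype S] {A : S → Type v} [∀ s, Fintype (A s)] {M : SSP S A}
  {πf : ∀ s, A s} {H₁ H₂ : ℕ} {Ω : Type w} {mΩ : MeasurableSpace Ω} {μ : Measure Ω}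
  [IsProbabilityMeasure μ] {𝓕 : Filtration ℕ mΩ} {K : ℕ} {c : Fin K → Ω → (Σ s, A s) → ℝ}
  {π : Fin K → Ω → Policy (Action A (H₁ + H₂))} {X : Fin K → Ω → ℕ → Step A}

namespace IsPlay

variable (hP : IsPlay M πf H₁ H₂ μ 𝓕 c π X)

include hP

/-- With `Y` the cost of the visits, `η * Y ≤ 1` permits `exp u ≤ 1 + u + u ^ 2`, and `Y ^ 2` is at
most twice the layer-weighted cost. The resulting bound is linear in the visit counts, whose
conditional means are the occupancies. -/
theorem exp_step_le (h₁ : 0 < H₁) (k : Fin K) {η : ℝ} (hη : 0 < η)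
    (hηH : η * (H₁ + H₂ : ℕ) ≤ 1) {W : Ω → ℝ} (hW : AEStronglyMeasurable[𝓕 (k : ℕ)] W μ)
    (hW0 : ∀ ω, 0 ≤ W ω) {b : ℝ} (hb : ∀ ω, W ω ≤ b) :
    ∫ ω, W ω * Real.exp (η * pairing (visits H₁ H₂ (X k ω)) (cost (c k ω))) ∂μ ≤
      ∫ ω, W ω * (1 + (η * pairing (occ M H₁ H₂ h₁ (π k ω)) (cost (c k ω)) +
        2 * η ^ 2 * pairing (occ M H₁ H₂ h₁ (π k ω)) (layerMul (cost (c k ω))))) ∂μ := by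
  -- The weight and both linear terms are merged into one test function, known at the start of
  -- episode `k`, so that visits are exchanged for occupancies only once.
  let g : Ω → Triple A (H₁ + H₂) → ℝ := fun ω p =>
    W ω * (η * cost (c k ω) p + 2 * η ^ 2 * layerMul (cost (c k ω)) p)
  have hcm : ∀ p, AEStronglyMeasurable[𝓕 (k : ℕ)] (fun ω => cost (c k ω) p) μ := fun p =>
    (hP.measurable_cost k p).stronglyMeasurable.aestronglyMeasurable
  have hg : ∀ p, AEStronglyMeasurable[𝓕 (k : ℕ)] (fun ω => g ω p) μ := fun p =>
    hW.mul (((hcm p).const_mul η).add (((hcm p).const_mul _).const_mul (2 * η ^ 2)))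
  have hgb : ∀ ω p, |g ω p| ≤ b * (η * 1 + 2 * η ^ 2 * (H₁ + H₂ : ℕ)) := by
    intro ω p
    have hc0 : ∀ p, 0 ≤ cost (c k ω) p := fun p => (hP.loopFree_cost_mem k ω p).1
    have hc1 : ∀ p, cost (c k ω) p ≤ 1 := fun p => (hP.loopFree_cost_mem k ω p).2
    have h1 := layerMul_nonneg hc0 p
    have h2 := layerMul_le hc0 hc1 p
    have h3 := hc0 p
    have h4 := hc1 p
    have h5 := hW0 ω
    rw [abs_of_nonneg (by positivity)]
    exact mul_le_mul (hb ω) (by gcongr) (by positivity) (h5.trans (hb ω))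
  have hWi : Integrable W μ := Integrable.of_bound (hW.mono (𝓕.le _)) b
    (Filter.Eventually.of_forall fun ω => by
      rw [Real.norm_eq_abs, abs_of_nonneg (hW0 ω)]; exact hb ω)
  have hlin : ∀ ω (f : Triple A (H₁ + H₂) → ℝ), pairing f (g ω) = W ω *
      (η * pairing f (cost (c k ω)) + 2 * η ^ 2 * pairing f (layerMul (cost (c k ω)))) := by
    intro ω f
    simp only [g]
    rw [pairing_const_mul, pairing_add, pairing_const_mul, pairing_const_mul]
  have hR : ∫ ω, W ω * (1 + (η * pairing (occ M H₁ H₂ h₁ (π k ω)) (cost (c k ω)) +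
        2 * η ^ 2 * pairing (occ M H₁ H₂ h₁ (π k ω)) (layerMul (cost (c k ω))))) ∂μ =
      ∫ ω, (W ω + pairing (visits H₁ H₂ (X k ω)) (g ω)) ∂μ := by
    rw [integral_add hWi (hP.integrable_pairing_visits k hg hgb),
      hP.integral_pairing_visits h₁ k hg hgb,
      ← integral_add hWi (hP.integrable_pairing_occ h₁ k hg hgb)]
    refine integral_congr_ae (Filter.Eventually.of_forall fun ω => ?_)
    simp only [hlin]
    ring
  rw [hR]
  refine integral_mono_of_nonneg (Filter.Eventually.of_forall fun ω =>
    mul_nonneg (hW0 ω) (Real.exp_pos _).le)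
    (hWi.add (hP.integrable_pairing_visits k hg hgb)) (Filter.Eventually.of_forall fun ω => ?_)
  simp only [hlin]
  have h1 := pairing_visits_mem H₁ H₂ (X k ω) (hP.loopFree_cost_mem k ω)
  have h2 := sq_pairing_visits_le H₁ H₂ (X k ω) (hP.loopFree_cost_mem k ω)
  set Y := pairing (visits H₁ H₂ (X k ω)) (cost (c k ω))
  have h3 : |η * Y| ≤ 1 := by
    rw [abs_of_nonneg (mul_nonneg hη.le h1.1)]
    exact (mul_le_mul_of_nonneg_left h1.2 hη.le).trans hηH
  have h4 := (abs_le.1 (Real.abs_exp_sub_one_sub_id_le h3)).2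
  have h5 := mul_le_mul_of_nonneg_left h2 (sq_nonneg η)
  have h6 : Real.exp (η * Y) ≤
      1 + (η * Y + 2 * η ^ 2 * pairing (visits H₁ H₂ (X k ω)) (layerMul (cost (c k ω)))) := by
    nlinarith
  calc W ω * Real.exp (η * Y) ≤ W ω * _ := mul_le_mul_of_nonneg_left h6 (hW0 ω)
    _ = _ := by ring

/-- The deviation of the costs of the visit counts from their conditional expectations. -/
theorem measure_visits_gt_le (h₁ : 0 < H₁) {lam : ℝ} (hl : 0 < lam)
    (hl2 : lam ≤ 2 / ((H₁ + H₂ : ℕ) : ℝ)) {ε : ℝ} (hε : 0 < ε) :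
    μ {ω | ¬ (∑ k, pairing (visits H₁ H₂ (X k ω)) (cost (c k ω)) ≤
      ∑ k, pairing (occ M H₁ H₂ h₁ (π k ω)) (cost (c k ω)) +
        lam * ∑ k, pairing (occ M H₁ H₂ h₁ (π k ω)) (layerMul (cost (c k ω))) +
        2 * Real.log (1 / ε) / lam)} ≤ ENNReal.ofReal ε := by
  -- The exponent is `η = lam / 2`: then `lam ≤ 2 / H` means `η * H ≤ 1`, and dividing by `η` turns
  -- `2 * η ^ 2` into `lam` and the logarithm into `2 * log / lam`.
  have hη : 0 < lam / 2 := by positivity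
  have hH : (0 : ℝ) < (H₁ + H₂ : ℕ) := by exact_mod_cast Nat.lt_add_right H₂ h₁
  have hηH : lam / 2 * (H₁ + H₂ : ℕ) ≤ 1 := by
    rw [le_div_iff₀ hH] at hl2
    linarith
  -- Padding by zero after episode `K` fits the episodes to processes indexed by `ℕ`.
  let f : ℕ → Ω → ℝ := fun n ω => if h : n < K then
    lam / 2 * pairing (visits H₁ H₂ (X ⟨n, h⟩ ω)) (cost (c ⟨n, h⟩ ω)) else 0
  let a : ℕ → Ω → ℝ := fun n ω => if h : n < K then
    lam / 2 * pairing (occ M H₁ H₂ h₁ (π ⟨n, h⟩ ω)) (cost (c ⟨n, h⟩ ω)) + 2 * (lam / 2) ^ 2 *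
      pairing (occ M H₁ H₂ h₁ (π ⟨n, h⟩ ω)) (layerMul (cost (c ⟨n, h⟩ ω))) else 0
  have hcm : ∀ (k : Fin K) p, AEStronglyMeasurable[𝓕 (k : ℕ)] (fun ω => cost (c k ω) p) μ := fun k p =>
    (hP.measurable_cost k p).stronglyMeasurable.aestronglyMeasurable
  have key := measure_sum_gt_le (μ := μ) 𝓕 (f := f) (a := a) ?_ ?_ ?_ ?_ ?_ K hε
  · refine le_trans (measure_mono ?_) key
    intro ω hω
    rw [Set.mem_ofPred_eq] at hω ⊢
    contrapose! hω
    rw [← Fin.sum_univ_eq_sum_range (fun i => f i ω - a i ω)] at hω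
    simp only [f, a, Fin.is_lt, dif_pos, Fin.eta, Finset.sum_sub_distrib, Finset.sum_add_distrib,
      ← Finset.mul_sum] at hω
    set x := ∑ k, pairing (visits H₁ H₂ (X k ω)) (cost (c k ω))
    set y := ∑ k, pairing (occ M H₁ H₂ h₁ (π k ω)) (cost (c k ω))
    set z := ∑ k, pairing (occ M H₁ H₂ h₁ (π k ω)) (layerMul (cost (c k ω)))
    have h1 : lam * (x - y - lam * z) ≤ 2 * Real.log (1 / ε) := by nlinarith
    have h2 : x - y - lam * z ≤ 2 * Real.log (1 / ε) / lam := by rwa [le_div_iff₀' hl]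
    linarith
  · intro n
    simp only [f]
    split_ifs with h
    · exact (hP.aestronglyMeasurable_pairing_visits ⟨n, h⟩ (hcm _)).const_mul _
    · exact aestronglyMeasurable_const
  · intro n
    simp only [a]
    split_ifs with h
    · exact ((hP.aestronglyMeasurable_pairing_occ h₁ ⟨n, h⟩ (hcm _)).const_mul _).add
        ((hP.aestronglyMeasurable_pairing_occ h₁ ⟨n, h⟩
          fun p => (hcm _ p).const_mul _).const_mul _)
    · exact aestronglyMeasurable_const
  · intro n ω
    simp only [f]
    split_ifs with h
    · exact (mul_le_mul_of_nonneg_left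
        (pairing_visits_mem H₁ H₂ _ (hP.loopFree_cost_mem ⟨n, h⟩ ω)).2 hη.le).trans hηH
    · exact zero_le_one
  · intro n ω
    simp only [a]
    split_ifs with h
    · have hc0 : ∀ p, 0 ≤ cost (c ⟨n, h⟩ ω) p := fun p => (hP.loopFree_cost_mem ⟨n, h⟩ ω p).1
      have h1 := pairing_nonneg (occ_nonneg M H₁ H₂ h₁ (π ⟨n, h⟩ ω)) hc0
      have h2 := pairing_nonneg (occ_nonneg M H₁ H₂ h₁ (π ⟨n, h⟩ ω)) (layerMul_nonneg hc0)
      positivity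
    · exact le_rfl
  · rintro n W hW hW0 ⟨b, hb⟩
    simp only [f, a]
    split_ifs with h
    · exact hP.exp_step_le h₁ ⟨n, h⟩ hη hηH hW hW0 hb
    · simp

omit [IsProbabilityMeasure μ] in
theorem measurableSet_ne_none (k : Fin K) (n : ℕ) : MeasurableSet {ω | X k ω n ≠ none} :=
  hP.measurable_traj k (SSP.measurableSet_coord n {y | y ≠ none})

theorem lintegral_stepCost_one (k : Fin K) (n : ℕ) :
    ∫⁻ ω, ENNReal.ofReal (SSP.stepCost (fun _ => 1) (X k ω n)) ∂μ =
      ENNReal.ofReal (∫ ω, M.surv (sigma H₁ H₂ πf (π k ω)) n (some M.init) ∂μ) := by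
  rw [← hP.measureReal_ne_none, ofReal_measureReal,
    ← lintegral_indicator_one (hP.measurableSet_ne_none k n)]
  refine lintegral_congr fun ω => ?_
  by_cases h : X k ω n = none
  · rw [Set.indicator_of_notMem (show ω ∉ {ω | X k ω n ≠ none} from not_not.2 h), h]
    simp [SSP.stepCost]
  · rw [Set.indicator_of_mem (show ω ∈ {ω | X k ω n ≠ none} from h)]
    obtain ⟨p, hp⟩ := Option.ne_none_iff_exists'.1 h
    simp [hp, SSP.stepCost]

omit [IsProbabilityMeasure μ] in
theorem measurable_tailSteps (k : Fin K) (N : ℕ) :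
    Measurable fun ω => SSP.tailSteps N (X k ω) := by
  refine Measurable.tsum fun j => ?_
  exact ((measurable_from_top (f := fun y : Step A =>
    ENNReal.ofReal (SSP.stepCost (fun _ => 1) y))).comp (measurable_pi_apply (N + j))).comp
      (hP.measurable_traj k)

/-- Tonelli reduces the expectation to survival probabilities at times after `H₁ + H₂`, whose sum is
bounded for every policy the learner may have chosen. -/
theorem lintegral_tailSteps_le (hf : M.IsFast πf) (k : Fin K) :
    ∫⁻ ω, SSP.tailSteps (H₁ + H₂) (X k ω) ∂μ ≤
      ENNReal.ofReal (M.diameter * Real.exp (-H₂ / M.diameter)) := by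
  unfold SSP.tailSteps
  rw [lintegral_tsum]
  · refine ENNReal.tsum_le_of_sum_range_le fun n => ?_
    simp only [hP.lintegral_stepCost_one]
    rw [← ENNReal.ofReal_sum_of_nonneg fun j _ => integral_nonneg fun ω => M.surv_nonneg _ _ _,
      ← integral_finsetSum _ fun j _ => hP.integrable_surv k _]
    refine ENNReal.ofReal_le_ofReal ?_
    have h1 : ∀ ω, ∑ j ∈ Finset.range n,
        M.surv (sigma H₁ H₂ πf (π k ω)) (H₁ + H₂ + j) (some M.init) ≤
          M.diameter * Real.exp (-H₂ / M.diameter) := fun ω =>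
      ((summable_surv_sigma M H₁ H₂ hf (π k ω) H₂ (some M.init)).sum_le_tsum _
        fun _ _ => M.surv_nonneg _ _ _).trans (tsum_surv_sigma_le M H₁ H₂ hf (π k ω) H₂ _)
    refine (integral_mono (integrable_finsetSum _ fun j _ => hP.integrable_surv k _)
      (integrable_const _) h1).trans ?_
    simp
  · exact fun j => ((measurable_from_top (f := fun y : Step A =>
      ENNReal.ofReal (SSP.stepCost (fun _ => 1) y))).comp
        ((measurable_pi_apply (H₁ + H₂ + j)).comp (hP.measurable_traj k))).aemeasurable

theorem integrable_tailSteps (hf : M.IsFast πf) (k : Fin K) :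
    Integrable (fun ω => (SSP.tailSteps (H₁ + H₂) (X k ω)).toReal) μ :=
  integrable_toReal_of_lintegral_ne_top (hP.measurable_tailSteps k _).aemeasurable
    ((hP.lintegral_tailSteps_le hf k).trans_lt ENNReal.ofReal_lt_top).ne

theorem tailSteps_ne_top (hf : M.IsFast πf) (k : Fin K) :
    ∀ᵐ ω ∂μ, SSP.tailSteps (H₁ + H₂) (X k ω) ≠ ∞ := by
  filter_upwards [ae_lt_top (hP.measurable_tailSteps k (H₁ + H₂))
    ((hP.lintegral_tailSteps_le hf k).trans_lt ENNReal.ofReal_lt_top).ne] with ω hω using hω.ne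

theorem integral_tailSteps_le (hf : M.IsFast πf) (k : Fin K) :
    ∫ ω, (SSP.tailSteps (H₁ + H₂) (X k ω)).toReal ∂μ ≤
      M.diameter * Real.exp (-H₂ / M.diameter) := by
  rw [integral_toReal (hP.measurable_tailSteps k _).aemeasurable
    ((hP.tailSteps_ne_top hf k).mono fun _ h => h.lt_top)]
  refine ENNReal.toReal_le_of_le_ofReal ?_ (hP.lintegral_tailSteps_le hf k)
  exact mul_nonneg (zero_le_one.trans (one_le_diameter M hf)) (Real.exp_pos _).le

theorem measure_ne_none_le (hf : M.IsFast πf) (k : Fin K) :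
    μ {ω | X k ω (H₁ + H₂) ≠ none} ≤ ENNReal.ofReal (Real.exp (1 - H₂ / M.diameter)) := by
  rw [← ofReal_measureReal, hP.measureReal_ne_none]
  refine ENNReal.ofReal_le_ofReal ?_
  refine (integral_mono (hP.integrable_surv k _) (integrable_const _)
    fun ω => surv_sigma_le M H₁ H₂ hf (π k ω) H₂ _).trans ?_
  simp

theorem total_cost_le (hf : M.IsFast πf) (k : Fin K) :
    ∀ᵐ ω ∂μ, ∑' i, SSP.stepCost (c k ω) (X k ω i) ≤
      pairing (visits H₁ H₂ (X k ω)) (cost (c k ω)) +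
        (SSP.tailSteps (H₁ + H₂) (X k ω)).toReal := by
  filter_upwards [hP.absorbing k, hP.tailSteps_ne_top hf k] with ω h1 h2
  rw [pairing_visits_cost]
  exact SSP.tsum_stepCost_le h1 (fun p => (hP.cost_mem k ω p).1)
    (fun p => (hP.cost_mem k ω p).2) H₁ H₂ h2

omit [IsProbabilityMeasure μ] in
theorem measurable_total_cost (k : Fin K) :
    Measurable fun ω => ∑' i, SSP.stepCost (c k ω) (X k ω i) := by
  refine Measurable.tsum fun i => ?_
  have h1 : Measurable fun z : Step A × ((Σ s, A s) → ℝ) => SSP.stepCost z.2 z.1 :=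
    measurable_from_prod_countable_right fun y => SSP.measurable_stepCost y
  exact h1.comp (((measurable_pi_apply i).comp (hP.measurable_traj k)).prodMk
    (measurable_pi_iff.2 fun p => (hP.cost_adapted k p).mono (𝓕.le _) le_rfl))

theorem integrable_cost_visits (k : Fin K) :
    Integrable (fun ω => pairing (visits H₁ H₂ (X k ω)) (cost (c k ω))) μ :=
  hP.integrable_pairing_visits k
    (fun p => (hP.measurable_cost k p).stronglyMeasurable.aestronglyMeasurable) (b := 1)
    fun ω p => abs_le.2 ⟨by linarith [(hP.loopFree_cost_mem k ω p).1], (hP.loopFree_cost_mem k ω p).2⟩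

theorem integrable_cost_occ (h₁ : 0 < H₁) (k : Fin K) :
    Integrable (fun ω => pairing (occ M H₁ H₂ h₁ (π k ω)) (cost (c k ω))) μ :=
  hP.integrable_pairing_occ h₁ k
    (fun p => (hP.measurable_cost k p).stronglyMeasurable.aestronglyMeasurable) (b := 1)
    fun ω p => abs_le.2 ⟨by linarith [(hP.loopFree_cost_mem k ω p).1], (hP.loopFree_cost_mem k ω p).2⟩

theorem integral_cost_visits (h₁ : 0 < H₁) (k : Fin K) :
    ∫ ω, pairing (visits H₁ H₂ (X k ω)) (cost (c k ω)) ∂μ =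
      ∫ ω, pairing (occ M H₁ H₂ h₁ (π k ω)) (cost (c k ω)) ∂μ :=
  hP.integral_pairing_visits h₁ k
    (fun p => (hP.measurable_cost k p).stronglyMeasurable.aestronglyMeasurable) (b := 1)
    fun ω p => abs_le.2 ⟨by linarith [(hP.loopFree_cost_mem k ω p).1], (hP.loopFree_cost_mem k ω p).2⟩

theorem integrable_total_cost (hf : M.IsFast πf) (k : Fin K) :
    Integrable (fun ω => ∑' i, SSP.stepCost (c k ω) (X k ω i)) μ := by
  refine ((hP.integrable_cost_visits k).add (hP.integrable_tailSteps hf k)).mono'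
    (hP.measurable_total_cost k).aestronglyMeasurable ?_
  filter_upwards [hP.total_cost_le hf k] with ω hω
  rw [Real.norm_eq_abs, abs_of_nonneg]
  · exact hω
  · exact tsum_nonneg fun i => SSP.stepCost_nonneg (fun p => (hP.cost_mem k ω p).1) _

end IsPlay

end Play

end LoopFree

/-! ### Numerical consequences of the choice of `H₁` and `H₂` -/

section Numerics

variable {K : ℕ} {δ D : ℝ}

theorem four_mul_le_div (hδ : 0 < δ) (hδ1 : δ < 1) : 4 * (K : ℝ) ≤ 4 * K / δ := by
  rw [le_div_iff₀ hδ]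
  exact mul_le_of_le_one_right (by positivity) hδ1.le

theorem one_le_log (hK : 0 < K) (hδ : 0 < δ) (hδ1 : δ < 1) : 1 ≤ Real.log (4 * K / δ) := by
  have hK1 : (1 : ℝ) ≤ K := by exact_mod_cast hK
  have h1 := four_mul_le_div (K := K) hδ hδ1
  rw [Real.le_log_iff_exp_le (by positivity)]
  linarith [Real.exp_one_lt_d9]

theorem exp_neg_ceil_le (hK : 0 < K) (hδ : 0 < δ) (hD : 1 ≤ D) :
    Real.exp (-(⌈4 * D * Real.log (4 * K / δ)⌉₊ : ℝ) / D) ≤ ((4 * K / δ) ^ 4)⁻¹ := by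
  have hK1 : (0 : ℝ) < K := by exact_mod_cast hK
  have hy : 0 < 4 * K / δ := by positivity
  rw [← Real.log_le_log_iff (Real.exp_pos _) (by positivity), Real.log_exp, Real.log_inv,
    Real.log_pow, div_le_iff₀ (by linarith)]
  have := Nat.le_ceil (4 * D * Real.log (4 * K / δ))
  push_cast
  linarith

/-- Rounding up costs at most `1 ≤ D * log (4 * K / δ)`. -/
theorem ceil_le (hK : 0 < K) (hδ : 0 < δ) (hδ1 : δ < 1) (hD : 1 ≤ D) :
    (⌈4 * D * Real.log (4 * K / δ)⌉₊ : ℝ) ≤ 5 * D * Real.log (4 * K / δ) := by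
  have hL := one_le_log hK hδ hδ1
  have h1 := (Nat.ceil_lt_add_one (show 0 ≤ 4 * D * Real.log (4 * K / δ) by positivity)).le
  nlinarith [mul_le_mul hD hL zero_le_one (by linarith : 0 ≤ D)]

theorem mul_exp_one_sub_ceil_le (hK : 0 < K) (hδ : 0 < δ) (hδ1 : δ < 1) (hD : 1 ≤ D) :
    K * Real.exp (1 - (⌈4 * D * Real.log (4 * K / δ)⌉₊ : ℝ) / D) ≤ δ / 2 := by
  have hK1 : (1 : ℝ) ≤ K := by exact_mod_cast hK
  have h1 := exp_neg_ceil_le hK hδ hD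
  have h2 := four_mul_le_div (K := K) hδ hδ1
  rw [sub_eq_add_neg, Real.exp_add, ← neg_div]
  have hy4 : 4 ≤ 4 * K / δ := by linarith
  have hKy : (K : ℝ) = 4 * K / δ * δ / 4 := by field_simp
  set y := 4 * K / δ
  -- Since `y = 4 * K / δ ≥ 4`, three of the four powers yield a constant and the last one cancels
  -- `K` and leaves `δ`.
  have h3 : (64 : ℝ) * y ≤ y ^ 4 := by
    have : (4 : ℝ) ^ 3 ≤ y ^ 3 := pow_le_pow_left₀ (by norm_num) hy4 3
    nlinarith
  have h4 : (y ^ 4)⁻¹ ≤ (64 * y)⁻¹ := inv_anti₀ (by positivity) h3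
  calc (K : ℝ) * (Real.exp 1 * _) ≤ K * (3 * (64 * y)⁻¹) := by
        gcongr
        · linarith [Real.exp_one_lt_d9]
        · exact h1.trans h4
    _ = y * δ / 4 * (3 * (64 * y)⁻¹) := by rw [← hKy]
    _ = 3 / 256 * δ := by field_simp; norm_num
    _ ≤ δ / 2 := by linarith

/-- The fourth power of `4 * K / δ` is at least `K ^ 2`, which leaves `D / K`; this term forces the
maximum in `r` when `D` exceeds `K`. -/
theorem mul_mul_exp_neg_ceil_le (hK : 0 < K) (hδ : 0 < δ) (hδ1 : δ < 1) (hD : 1 ≤ D) :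
    K * (D * Real.exp (-(⌈4 * D * Real.log (4 * K / δ)⌉₊ : ℝ) / D)) ≤
      max 1 (D / K) * Real.log (4 * K / δ) := by
  have hK1 : (1 : ℝ) ≤ K := by exact_mod_cast hK
  have h1 := exp_neg_ceil_le hK hδ hD
  have h2 := four_mul_le_div (K := K) hδ hδ1
  have hL := one_le_log hK hδ hδ1
  have h3 : (K : ℝ) ^ 2 ≤ (4 * K / δ) ^ 4 :=
    (pow_le_pow_right₀ hK1 (by norm_num : 2 ≤ 4)).trans
      (pow_le_pow_left₀ (by linarith) (by linarith) 4)
  calc K * (D * _) ≤ K * (D * ((K : ℝ) ^ 2)⁻¹) := by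
        gcongr
        exact h1.trans (inv_anti₀ (by positivity) h3)
    _ = D / K := by field_simp
    _ ≤ max 1 (D / K) := le_max_right _ _
    _ ≤ _ := le_mul_of_one_le_right (by positivity) hL

theorem mul_ceil_mul_exp_le (hK : 0 < K) (hδ : 0 < δ) (hδ1 : δ < 1) (hD : 1 ≤ D) {T : ℝ}
    (hT : 1 ≤ T) {H₁ : ℕ} (h₁ : 0 < H₁) (hH : 8 * T * Real.log K ≤ H₁) :
    K * ((⌈4 * D * Real.log (4 * K / δ)⌉₊ : ℝ) * Real.exp (1 - (H₁ - 1 : ℕ) / T)) ≤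
      45 * (max 1 (D / K) * Real.log (4 * K / δ)) := by
  have hK1 : (1 : ℝ) ≤ K := by exact_mod_cast hK
  have hL := one_le_log hK hδ hδ1
  have hlogK := Real.log_nonneg hK1
  have h1 : Real.exp (1 - (H₁ - 1 : ℕ) / T) ≤ 9 * ((K : ℝ) ^ 2)⁻¹ := by
    -- One unit comes from the decay estimate and one from `1 / T ≤ 1`; of `8 * log K` only `2 * log
    -- K` is needed. Then `exp 2 ≤ 9`, and `45 = 5 * 9` with the `5` of `ceil_le`.
    have h2 : (1 - (H₁ - 1 : ℕ) / T) ≤ 1 + 1 + -(2 * Real.log K) := by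
      have : 2 * Real.log K - 1 ≤ (H₁ - 1 : ℕ) / T := by
        rw [le_div_iff₀ (by linarith), Nat.cast_sub h₁, Nat.cast_one]
        nlinarith [mul_nonneg (zero_le_one.trans hT) hlogK]
      linarith
    refine (Real.exp_le_exp.2 h2).trans ?_
    rw [Real.exp_add, Real.exp_add, Real.exp_neg, two_mul, Real.exp_add,
      Real.exp_log (by linarith), ← sq (K : ℝ)]
    gcongr
    nlinarith [Real.exp_one_lt_d9, Real.exp_pos 1]
  calc _ ≤ K * (5 * D * Real.log (4 * K / δ) * (9 * ((K : ℝ) ^ 2)⁻¹)) := by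
        gcongr
        exact ceil_le hK hδ hδ1 hD
    _ = 45 * (D / K * Real.log (4 * K / δ)) := by field_simp; ring
    _ ≤ _ := by
        gcongr
        exact le_max_right _ _

end Numerics

/-- A random choice among finitely many measurable functions is measurable. -/
theorem measurable_finite_choice {Ω ι : Type*} {mΩ : MeasurableSpace Ω} [Finite ι] {i : Ω → ι}
    (hi : ∀ j, MeasurableSet {ω | i ω = j}) {F : ι → Ω → ℝ} (hF : ∀ j, Measurable (F j)) :
    Measurable fun ω => F (i ω) ω := by
  let _ : MeasurableSpace ι := ⊤
  have h1 : Measurable i := measurable_to_countable' fun j => hi j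
  have h2 : Measurable fun z : ι × Ω => F z.1 z.2 := measurable_from_prod_countable_right hF
  exact h2.comp (h1.prodMk measurable_id)

/-! ### Integrability of the regrets and their comparison -/

namespace LoopFree

namespace IsPlay

variable {S : Type u} [Fintype S] {A : S → Type v} [∀ s, Fintype (A s)] {M : SSP S A}
  {πf : ∀ s, A s} {H₁ H₂ : ℕ} {Ω : Type w} {mΩ : MeasurableSpace Ω} {μ : Measure Ω}
  [IsProbabilityMeasure μ] {𝓕 : Filtration ℕ mΩ} {K : ℕ} {c : Fin K → Ω → (Σ s, A s) → ℝ}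
  {π : Fin K → Ω → Policy (Action A (H₁ + H₂))} {X : Fin K → Ω → ℕ → Step A}
  (hP : IsPlay M πf H₁ H₂ μ 𝓕 c π X) {πs : Ω → ∀ s, A s}

include hP

theorem integrable_costToGo (hπs : ∀ π₀ : ∀ s, A s, MeasurableSet {ω | πs ω = π₀})
    (hprop : ∀ᵐ ω ∂μ, M.Proper (detPolicy (πs ω))) (k : Fin K) :
    Integrable (fun ω => M.costToGo (detPolicy (πs ω)) (c k ω) M.init) μ := by
  have hm : Measurable fun ω => M.costToGo (detPolicy (πs ω)) (c k ω) M.init :=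
    measurable_finite_choice hπs (F := fun π₀ ω => M.costToGo (detPolicy π₀) (c k ω) M.init)
      fun π₀ => (M.measurable_costToGo (detPolicy π₀) M.init).comp
        (measurable_pi_iff.2 fun p => (hP.cost_adapted k p).mono (𝓕.le _) le_rfl)
  -- There are finitely many deterministic policies, so the hitting time of the random comparator
  -- has a constant bound.
  obtain ⟨b, hb⟩ := (Set.finite_range fun π₀ : ∀ s, A s =>
    (M.hitTime (detPolicy π₀) M.init).toReal).bddAbove
  refine Integrable.of_bound hm.aestronglyMeasurable b ?_
  filter_upwards [hprop] with ω hω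
  rw [Real.norm_eq_abs, abs_of_nonneg (show 0 ≤ M.costToGo _ _ _ from ENNReal.toReal_nonneg)]
  exact (M.costToGo_le hω (fun p => (hP.cost_mem k ω p).2) M.init).trans
    (hb (Set.mem_range_self (πs ω)))

theorem integrable_cost_occStar (h₁ : 0 < H₁)
    (hπs : ∀ π₀ : ∀ s, A s, MeasurableSet {ω | πs ω = π₀}) (k : Fin K) :
    Integrable (fun ω => pairing (occStar M H₁ H₂ h₁ (πs ω)) (cost (c k ω))) μ := by
  refine integrable_finsetSum _ fun p _ => integrable_mul_of_le_one (b := 1) ?_ ?_ ?_ ?_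
  · exact (measurable_finite_choice hπs (F := fun π₀ _ => occStar M H₁ H₂ h₁ π₀ p)
      fun π₀ => measurable_const).aestronglyMeasurable
  · exact ((hP.measurable_cost k p).mono (𝓕.le _) le_rfl).aestronglyMeasurable
  · exact fun ω => ⟨occ_nonneg _ _ _ _ _ _, occ_le_one M h₁ _ p⟩
  · exact fun ω => abs_le.2 ⟨by linarith [(hP.loopFree_cost_mem k ω p).1], (hP.loopFree_cost_mem k ω p).2⟩

theorem integrable_regret (hf : M.IsFast πf)
    (hπs : ∀ π₀ : ∀ s, A s, MeasurableSet {ω | πs ω = π₀})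
    (hprop : ∀ᵐ ω ∂μ, M.Proper (detPolicy (πs ω))) :
    Integrable (fun ω => M.regret (fun k => c k ω) (fun k => X k ω) (πs ω)) μ :=
  (integrable_finsetSum _ fun k _ => hP.integrable_total_cost hf k).sub
    (integrable_finsetSum _ fun k _ => hP.integrable_costToGo hπs hprop k)

theorem integrable_loopFree_regret (h₁ : 0 < H₁)
    (hπs : ∀ π₀ : ∀ s, A s, MeasurableSet {ω | πs ω = π₀}) :
    Integrable (fun ω => regret M H₁ H₂ h₁ (fun k => c k ω) (fun k => π k ω) (πs ω)) μ := by
  simp only [regret, pairing_sub_left]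
  exact integrable_finsetSum _ fun k _ =>
    (hP.integrable_cost_occ h₁ k).sub (hP.integrable_cost_occStar h₁ hπs k)

theorem integrable_realizedRegret (h₁ : 0 < H₁)
    (hπs : ∀ π₀ : ∀ s, A s, MeasurableSet {ω | πs ω = π₀}) :
    Integrable (fun ω => realizedRegret M H₁ H₂ h₁ (fun k => c k ω) (fun k => X k ω) (πs ω)) μ := by
  simp only [realizedRegret, pairing_sub_left]
  exact integrable_finsetSum _ fun k _ =>
    (hP.integrable_cost_visits k).sub (hP.integrable_cost_occStar h₁ hπs k)

/-- Only the learner's terms need conditioning. The comparator may depend on all costs, including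
later ones, but its terms are the same on both sides. -/
theorem integral_realizedRegret (h₁ : 0 < H₁)
    (hπs : ∀ π₀ : ∀ s, A s, MeasurableSet {ω | πs ω = π₀}) :
    ∫ ω, realizedRegret M H₁ H₂ h₁ (fun k => c k ω) (fun k => X k ω) (πs ω) ∂μ =
      ∫ ω, regret M H₁ H₂ h₁ (fun k => c k ω) (fun k => π k ω) (πs ω) ∂μ := by
  simp only [regret, realizedRegret, pairing_sub_left]
  refine (integral_finsetSum _ fun k _ => (hP.integrable_cost_visits k).sub
    (hP.integrable_cost_occStar h₁ hπs k)).trans (Eq.trans ?_ (integral_finsetSum _ fun k _ =>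
      (hP.integrable_cost_occ h₁ k).sub (hP.integrable_cost_occStar h₁ hπs k)).symm)
  refine Finset.sum_congr rfl fun k _ => ?_
  simp only [Pi.sub_apply]
  rw [integral_sub (hP.integrable_cost_visits k) (hP.integrable_cost_occStar h₁ hπs k),
    integral_sub (hP.integrable_cost_occ h₁ k) (hP.integrable_cost_occStar h₁ hπs k),
    hP.integral_cost_visits h₁ k]

/-- The regret exceeds the realized regret of the loop-free instance by at most the number of steps
after time `H₁ + H₂`, up to the given constant. -/
theorem regret_le (hf : M.IsFast πf) (hK : 0 < K) (h₁ : 0 < H₁) {δ : ℝ} (hδ : 0 < δ) (hδ1 : δ < 1)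
    (hH₂ : H₂ = ⌈4 * M.diameter * Real.log (4 * K / δ)⌉₊)
    (hprop : ∀ᵐ ω ∂μ, M.Proper (detPolicy (πs ω)))
    (hT : ∀ᵐ ω ∂μ, 8 * M.maxHitTime (detPolicy (πs ω)) * Real.log K ≤ H₁) :
    ∀ᵐ ω ∂μ, M.regret (fun k => c k ω) (fun k => X k ω) (πs ω) ≤
      realizedRegret M H₁ H₂ h₁ (fun k => c k ω) (fun k => X k ω) (πs ω) +
        ∑ k, (SSP.tailSteps (H₁ + H₂) (X k ω)).toReal +
        45 * (max 1 (M.diameter / K) * Real.log (4 * K / δ)) := by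
  filter_upwards [hprop, hT, ae_all_iff.2 (hP.total_cost_le hf)] with ω h1 h2 h3
  have hT1 := M.one_le_maxHitTime h1
  have h4 : ∀ k, pairing (occStar M H₁ H₂ h₁ (πs ω)) (cost (c k ω)) ≤
      M.costToGo (detPolicy (πs ω)) (c k ω) M.init + H₂ *
        Real.exp (1 - (H₁ - 1 : ℕ) / M.maxHitTime (detPolicy (πs ω))) := by
    intro k
    refine (pairing_occStar_le M H₁ H₂ h₁ h1 (fun p => (hP.cost_mem k ω p).1)
      (fun p => (hP.cost_mem k ω p).2)).trans ?_
    gcongr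
    exact M.surv_le_exp _ (M.summable_of_proper h1) (M.tsum_surv_le_maxHitTime h1) hT1 _ _
  have h5 := mul_ceil_mul_exp_le hK hδ hδ1 (one_le_diameter M hf) hT1 h₁ h2
  rw [← hH₂] at h5
  have h6 := Finset.sum_le_sum fun k (_ : k ∈ Finset.univ) => h3 k
  have h7 := Finset.sum_le_sum fun k (_ : k ∈ Finset.univ) => h4 k
  simp only [Finset.sum_add_distrib, Finset.sum_const, Finset.card_univ, Fintype.card_fin,
    nsmul_eq_mul] at h6 h7
  simp only [SSP.regret, realizedRegret, pairing_sub_left, Finset.sum_sub_distrib]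
  linarith

end IsPlay

end LoopFree

/-! ### The main theorem -/

theorem mainTheorem8 :
    ∃ C : ℝ, 0 < C ∧
      ∀ {S : Type u} [Fintype S] {A : S → Type v} [∀ s, Fintype (A s)]
        (M : SSP S A) (πf : ∀ s, A s) (_ : M.IsFast πf)
        (K H₁ H₂ : ℕ) (_ : 0 < K) (h₁ : 0 < H₁)
        (δ : ℝ) (_ : 0 < δ) (_ : δ < 1)
        (_ : H₂ = ⌈4 * M.diameter * Real.log (4 * K / δ)⌉₊)
        {Ω : Type w} {mΩ : MeasurableSpace Ω} (μ : Measure Ω) [IsProbabilityMeasure μ]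
        (𝓕 : Filtration ℕ mΩ)
        (c : Fin K → Ω → (Σ s, A s) → ℝ)
        (π : Fin K → Ω → Policy (LoopFree.Action A (H₁ + H₂)))
        (X : Fin K → Ω → ℕ → Step A)
        (_ : LoopFree.IsPlay M πf H₁ H₂ μ 𝓕 c π X)
        (πs : Ω → ∀ s, A s)
        (_ : ∀ π₀ : ∀ s, A s, MeasurableSet {ω | πs ω = π₀})
        (_ : ∀ᵐ ω ∂μ, M.IsBest (fun k => c k ω) (πs ω))
        (_ : ∀ᵐ ω ∂μ, 8 * M.maxHitTime (detPolicy (πs ω)) * Real.log K ≤ H₁),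
        (∀ lam : ℝ, 0 < lam → lam ≤ 2 / ((H₁ + H₂ : ℕ) : ℝ) →
          μ {ω | ¬ (M.regret (fun k => c k ω) (fun k => X k ω) (πs ω) ≤
                LoopFree.realizedRegret M H₁ H₂ h₁ (fun k => c k ω) (fun k => X k ω) (πs ω)
                  + C * max 1 (M.diameter / K) * Real.log (4 * K / δ) ∧
              LoopFree.realizedRegret M H₁ H₂ h₁ (fun k => c k ω) (fun k => X k ω) (πs ω) ≤
                LoopFree.regret M H₁ H₂ h₁ (fun k => c k ω) (fun k => π k ω) (πs ω)
                  + lam * ∑ k, LoopFree.pairing (LoopFree.occ M H₁ H₂ h₁ (π k ω))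
                      (LoopFree.layerMul (LoopFree.cost (c k ω)))
                  + 2 * Real.log (2 / δ) / lam)} ≤ ENNReal.ofReal δ) ∧
        Integrable (fun ω => M.regret (fun k => c k ω) (fun k => X k ω) (πs ω)) μ ∧
        Integrable
          (fun ω => LoopFree.regret M H₁ H₂ h₁ (fun k => c k ω) (fun k => π k ω) (πs ω)) μ ∧
        ∫ ω, M.regret (fun k => c k ω) (fun k => X k ω) (πs ω) ∂μ ≤
          ∫ ω, LoopFree.regret M H₁ H₂ h₁ (fun k => c k ω) (fun k => π k ω) (πs ω) ∂μ
            + C * max 1 (M.diameter / K) * Real.log (4 * K / δ) := by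
  -- `45` pays for the truncation of the comparator and `1` for the expected number of steps after
  -- `H₁ + H₂`.
  refine ⟨46, by norm_num, ?_⟩
  intro S _ A _ M πf hf K H₁ H₂ hK h₁ δ hδ hδ1 hH₂ Ω mΩ μ _ 𝓕 c π X hP πs hπs hbest hT
  have hprop : ∀ᵐ ω ∂μ, M.Proper (detPolicy (πs ω)) := hbest.mono fun ω h => h.1
  have hD := LoopFree.one_le_diameter M hf
  have hL := one_le_log hK hδ hδ1
  have hr : 1 ≤ max 1 (M.diameter / K) * Real.log (4 * K / δ) :=
    one_le_mul_of_one_le_of_one_le (le_max_left _ _) hL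
  have hR := hP.regret_le hf hK h₁ hδ hδ1 hH₂ hprop hT
  refine ⟨fun lam hl hl2 => ?_, hP.integrable_regret hf hπs hprop,
    hP.integrable_loopFree_regret h₁ hπs, ?_⟩
  -- Half of `δ` goes to the deviation inequality and half to some episode lasting beyond `H₁ + H₂`.
  · have hdev := hP.measure_visits_gt_le h₁ hl hl2 (half_pos hδ)
    have htail : μ (⋃ k, {ω | X k ω (H₁ + H₂) ≠ none}) ≤ ENNReal.ofReal (δ / 2) := by
      refine (measure_iUnion_fintype_le μ _).trans
        ((Finset.sum_le_sum fun k _ => hP.measure_ne_none_le hf k).trans ?_)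
      rw [Finset.sum_const, Finset.card_univ, Fintype.card_fin, nsmul_eq_mul,
        ← ENNReal.ofReal_natCast, ← ENNReal.ofReal_mul (by positivity), hH₂]
      exact ENNReal.ofReal_le_ofReal (mul_exp_one_sub_ceil_le hK hδ hδ1 hD)
    have hsum : ENNReal.ofReal δ = ENNReal.ofReal (δ / 2) + ENNReal.ofReal (δ / 2) := by
      rw [← ENNReal.ofReal_add (by positivity) (by positivity), add_halves]
    rw [hsum]
    refine (measure_mono_ae ?_).trans ((measure_union_le _ _).trans (add_le_add htail hdev))
    filter_upwards [hR, ae_all_iff.2 hP.absorbing] with ω h1 h2 hω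
    by_contra hmem
    refine hω ⟨?_, ?_⟩
    · have h3 : ∀ k, X k ω (H₁ + H₂) = none := by
        intro k
        by_contra h
        exact hmem (Or.inl (Set.mem_iUnion.2 ⟨k, h⟩))
      simp only [fun k => SSP.tailSteps_eq_zero (h2 k) (h3 k), ENNReal.toReal_zero,
        Finset.sum_const_zero] at h1
      linarith
    -- The comparator terms cancel from the two regrets, which leaves exactly the deviation
    -- inequality.
    · by_contra h
      refine hmem (Or.inr fun h3 => h ?_)
      have h4 : (1 : ℝ) / (δ / 2) = 2 / δ := by field_simp
      rw [h4] at h3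
      simp only [LoopFree.regret, LoopFree.realizedRegret, LoopFree.pairing_sub_left,
        Finset.sum_sub_distrib]
      linarith
  · have hi1 := hP.integrable_realizedRegret h₁ hπs
    have hi2 : Integrable (fun ω => ∑ k, (SSP.tailSteps (H₁ + H₂) (X k ω)).toReal) μ :=
      integrable_finsetSum _ fun k _ => hP.integrable_tailSteps hf k
    have h1 := integral_mono_ae (hP.integrable_regret hf hπs hprop)
      ((hi1.add hi2).add (integrable_const _)) hR
    have h2 := integral_add (hi1.add hi2)
      (integrable_const (μ := μ) (45 * (max 1 (M.diameter / K) * Real.log (4 * K / δ))))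
    have h3 := integral_add hi1 hi2
    have h4 : ∫ ω, ∑ k, (SSP.tailSteps (H₁ + H₂) (X k ω)).toReal ∂μ ≤
        max 1 (M.diameter / K) * Real.log (4 * K / δ) := by
      rw [integral_finsetSum _ fun k _ => hP.integrable_tailSteps hf k]
      refine (Finset.sum_le_sum fun k _ => hP.integral_tailSteps_le hf k).trans ?_
      rw [Finset.sum_const, Finset.card_univ, Fintype.card_fin, nsmul_eq_mul, hH₂]
      exact mul_mul_exp_neg_ceil_le hK hδ hδ1 hD
    simp only [Pi.add_apply, integral_const, probReal_univ, smul_eq_mul, one_mul] at h1 h2 h3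
    rw [hP.integral_realizedRegret h₁ hπs] at h3
    linarith
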